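/- Let $\mathbb F$ be a field of characteristic $0$ and let $\mathcal V$ be a differential algebra over $\mathbb F$, i.e. a unital commutative associative $\mathbb F$-algebra with an $\mathbb F$-linear derivation $\partial$. A $\lambda$-bracket on $\mathcal V$ is an $\mathbb F$-bilinear map $\{\cdot\,_\lambda\,\cdot\}:\mathcal V\times\mathcal V\to\mathcal V[\lambda]$ such that, for all $a,b,c\in\mathcal V$, $$\{\partial a_\lambda b\}=-\lambda\{a_\lambda b\},\quad \{a_\lambda \partial b\}=(\lambda+\partial)\{a_\lambda b\},\quad \{a_\lambda bc\}=\{a_\lambda b\}c+\{a_\lambda c\}b,$$ $$\{ab_\lambda c\}=\{a_{\lambda+x}c\}\big(\big|_{x=\partial}b\big)+\{b_{\lambda+x}c\}\big(\big|_{x=\partial}a\big),$$ where $P(\lambda+x)\big(\big|_{x=\partial}b\big)=\sum_n p_n(\lambda+\partial)^n b$ for $P(\lambda)=\sum_n p_n\lambda^n\in\mathcal V[\lambda]$ (no skewsymmetry or Jacobi identity is assumed). A pseudodifferential operator $A(\partial)=\sum_{n\le N}a_n\partial^n\in\mathcal V((\partial^{-1}))$ has symbol $A(z)=\sum_{n\le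 N}a_nz^n$; the product is given by $(A\circ B)(z)=A(z+\partial)B(z)$, with $(z+\partial)^n$ expanded in non-negative powers of $\partial$, and the formal adjoint is $A^*(\partial)=\sum_n(-\partial)^n\circ a_n$. For matrices, the product is the usual one and $(A^*)_{ij}=(A_{ji})^*$. For operators $A,B$ put $\{A(z)_\lambda B(w)\}=\sum_{m,n}\{a_m{}_\lambda b_n\}z^mw^n$. A matrix $A=(A_{ij}(\partial))\in\mathrm{Mat}_{M\times N}\mathcal V((\partial^{-1}))$ is of Adler type with respect to $\{\cdot\,_\lambda\,\cdot\}$ if for all $i,h\in\{1,\dots,M\}$ and $j,k\in\{1,\dots,N\}$ $$\{A_{ij}(z)_\lambda A_{hk}(w)\}=A_{hj}(w+\lambda+\partial)\,\iota_z(z-w-\lambda-\partial)^{-1}(A_{ik})^*(\lambda-z)-A_{hj}(z)\,\iota_z(z-w-\lambda-\partial)^{-1}A_{ik}(w),$$ where $\iota_z(z-w-\lambda-\partial)^{-1}=\sum_{k\ge0}z^{-k-1}(w+\lambda+\partial)^k$, powers $(w+\lambda+\partial)^n$ are expanded in non-negative powers of $\lambda+\partial$, and powers $(\lambda-z)^m$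 in non-negative powers of $\lambda$. **Proposition.** Let $\{\cdot\,_\lambda\,\cdot\}$ be a $\lambda$-bracket on $\mathcal V$ and let $A(\partial)\in\mathrm{Mat}_{M\times N}\mathcal V((\partial^{-1}))$ be of Adler type with respect to it. Then: (a) For all subsets $I\subset\{1,\dots,M\}$, $J\subset\{1,\dots,N\}$ the submatrix $A_{IJ}=(A_{ij})_{i\in I,j\in J}$ is of Adler type. In particular every entry $A_{ij}(\partial)$ is a scalar pseudodifferential operator of Adler type. (b) The formal adjoint $A^*(\partial)\in\mathrm{Mat}_{N\times M}\mathcal V((\partial^{-1}))$ is of Adler type (with respect to the same $\lambda$-bracket). (c) If $M=N$ and $A(\partial)$ is invertible in $\mathrm{Mat}_{N\times N}\mathcal V((\partial^{-1}))$, then $A(\partial)^{-1}$ is of Adler type with respect to the opposite $\lambda$-bracket $-\{\cdot\,_\lambda\,\cdot\}$. (d) If $B(\partial)\in\mathrm{Mat}_{N\times P}\mathcal V((\partial^{-1}))$ is also of Adler type with respect to $\{\cdot\,_\lambda\,\cdot\}$, and $\{A_{ij}(z)_\lambda B_{hk}(w)\}=0$ and $\{B_{hk}(z)_\lambda A_{ij}(w)\}=0$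 for all $i,j,h,k$, then $A(\partial)\circ B(\partial)\in\mathrm{Mat}_{M\times P}\mathcal V((\partial^{-1}))$ is of Adler type. In particular, for all constant matrices $S\in\mathrm{Mat}_{P\times M}\mathbb F$ and $T\in\mathrm{Mat}_{N\times Q}\mathbb F$, the matrix $SA(\partial)T\in\mathrm{Mat}_{P\times Q}\mathcal V((\partial^{-1}))$ is of Adler type. -/

import Mathlib

open Polynomial

noncomputable section

namespace AdlerType

/-! ### Expressions of the form `A(z + T) g(z)` -/

section Shift

variable {V W : Type*} [CommRing V] [AddCommGroup W] [Module V W]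

/-- Let `a(z) = ∑ₙ aₙ zⁿ` and `g(z) = ∑ₘ gₘ zᵐ` be formal series and let `T` be an additive operator
on the space of coefficients of `g`, commuting with `z`.  This is the series
`a(z + T) g(z) = ∑ₙ aₙ (z + T)ⁿ g(z)`, where `(z + T)ⁿ = ∑_{k ≥ 0} (n choose k) z^(n-k) Tᵏ` is
expanded in non-negative powers of `T` (also for `n < 0`).  In all the cases of interest (`a` and
`g` bounded above in `z`), the sum defining each coefficient has finitely many nonzero terms. -/
def shiftApply (T : AddMonoid.End W) (a : ℤ → V) (g : ℤ → W) : ℤ → W := fun q =>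
  ∑ᶠ x : ℤ × ℕ, a x.1 • (Ring.choose x.1 x.2 • (T ^ x.2) (g (q - x.1 + x.2)))

/-- Multiplication of a series `g(z, w)` (with `g p q` the coefficient of `z^p w^q`) by `a(z)`. -/
def mulZ (a : ℤ → V) (g : ℤ → ℤ → W) : ℤ → ℤ → W := fun p q =>
  ∑ᶠ n : ℤ, a n • g (p - n) q

/-- Multiplication of a series `g(z, w)` by the operator `w + T`. -/
def wAdd (T : AddMonoid.End W) (g : ℤ → ℤ → W) : ℤ → ℤ → W := fun p q =>
  g p (q - 1) + T (g p q)

/-- `ι_z (z - w - T)⁻¹ g(z, w) = ∑_{k ≥ 0} z^(-k-1) (w + T)ᵏ g(z, w)`, the expansion for large `z`;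
here `T` acts on the coefficients of `g`. For `g` bounded above in `z` the sum defining each
coefficient is finite. -/
def iotaInv (T : AddMonoid.End W) (g : ℤ → ℤ → W) : ℤ → ℤ → W := fun p q =>
  ∑ᶠ k : ℕ, ((wAdd T)^[k] g) (p + k + 1) q

end Shift

/-! ### Pseudodifferential operators -/

/-- The space `V((∂⁻¹))` of scalar pseudodifferential operators `∑_{n ≤ N} aₙ ∂ⁿ` over `V`, through
their symbols: an operator `a` is the family of its coefficients `a n` (those of `∂ⁿ`, written on
the right), which vanishes for `n` large enough. -/
def pseudoDiff (V : Type*) [CommRing V] : Submodule V (ℤ → V) where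
  carrier := {a | ∃ N : ℤ, ∀ n, N < n → a n = 0}
  zero_mem' := ⟨0, fun _ _ => rfl⟩
  add_mem' := by
    rintro a b ⟨N, hN⟩ ⟨M, hM⟩
    refine ⟨max N M, fun n hn => ?_⟩
    simp [hN n (lt_of_le_of_lt (le_max_left _ _) hn), hM n (lt_of_le_of_lt (le_max_right _ _) hn)]
  smul_mem' := by
    rintro c a ⟨N, hN⟩
    exact ⟨N, fun n hn => by simp [hN n hn]⟩

/-- The type of scalar pseudodifferential operators over `V`. -/
abbrev PDO (V : Type*) [CommRing V] := ↥(pseudoDiff V)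

/-- The operator of multiplication by `c ∈ V`. -/
def PDO.const {V : Type*} [CommRing V] (c : V) : PDO V :=
  ⟨fun n => if n = 0 then c else 0, 0, fun n hn => by simp [hn.ne']⟩

section Diff

variable {F V : Type*} [Field F] [CommRing V] [Algebra F V]

/-- A derivation as an additive operator on `V`. -/
def derEnd (D : Derivation F V V) : AddMonoid.End V := (D : V →ₗ[F] V).toAddMonoidHom

/-- The product `A ∘ B` of pseudodifferential operators, given in terms of symbols by
`(A ∘ B)(z) = A(z + ∂) B(z)`. -/
def PDO.comp (D : Derivation F V V) (a b : PDO V) : PDO V :=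
  ⟨shiftApply (derEnd D) a.1 b.1, by
    obtain ⟨a, N, hN⟩ := a
    obtain ⟨b, M, hM⟩ := b
    refine ⟨N + M, fun q hq => ?_⟩
    refine (finsum_congr fun x => ?_).trans finsum_zero
    by_cases hx : N < x.1
    · simp [hN _ hx]
    · have : b (q - x.1 + x.2) = 0 := hM _ (by omega)
      simp [this]⟩

/-- The formal adjoint `A* = ∑ₙ (-∂)ⁿ ∘ aₙ = ∑ₙ ∑_{k ≥ 0} (-1)ⁿ (n choose k) aₙ⁽ᵏ⁾ ∂^(n-k)`. -/
def PDO.adjoint (D : Derivation F V V) (a : PDO V) : PDO V :=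
  ⟨fun p => ∑ᶠ k : ℕ, ((p + k).negOnePow : ℤ) • (Ring.choose (p + k) k • D^[k] (a.1 (p + k))), by
    obtain ⟨a, N, hN⟩ := a
    refine ⟨N, fun p hp => ?_⟩
    refine (finsum_congr fun k => ?_).trans finsum_zero
    have : a (p + k) = 0 := hN _ (by omega)
    simp [this]⟩

/-! ### Matrix pseudodifferential operators -/

/-- The product of matrix pseudodifferential operators. -/
def matComp {m n p : Type*} [Fintype n] (D : Derivation F V V)
    (A : Matrix m n (PDO V)) (B : Matrix n p (PDO V)) : Matrix m p (PDO V) :=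
  Matrix.of fun i j => ∑ k, PDO.comp D (A i k) (B k j)

/-- The formal adjoint of a matrix pseudodifferential operator: `(A*)ᵢⱼ = (Aⱼᵢ)*`. -/
def matAdjoint {m n : Type*} (D : Derivation F V V) (A : Matrix m n (PDO V)) :
    Matrix n m (PDO V) :=
  Matrix.of fun i j => PDO.adjoint D (A j i)

/-- A matrix with entries in the base field, as a matrix pseudodifferential operator. -/
def matConst {m n : Type*} (V : Type*) [CommRing V] [Algebra F V] (S : Matrix m n F) :
    Matrix m n (PDO V) :=
  Matrix.of fun i j => PDO.const (algebraMap F V (S i j))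

/-! ### `λ`-brackets.  The variable `λ` is the variable `X` of `V[X]`. -/

/-- The operator `λ + ∂` on `V[λ]`, where `∂` acts on coefficients. -/
def lamAdd (D : Derivation F V V) : AddMonoid.End V[X] where
  toFun P := X * P + P.sum fun n c => monomial n (D c)
  map_zero' := by simp
  map_add' P Q := by
    rw [Polynomial.sum_add_index _ _ _ (by simp) (by simp), mul_add]
    abel

/-- For `P(λ) = ∑ₙ pₙ λⁿ` and `b ∈ V`, this is `P(λ + x)(|_{x=∂} b) = ∑ₙ pₙ (λ + ∂)ⁿ b`. -/
def shiftEval (D : Derivation F V V) (P : V[X]) (b : V) : V[X] :=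
  P.sum fun n c => C c * (lamAdd D ^ n) (C b)

/-- A `λ`-bracket on the differential algebra `(V, ∂)` over `F`: an `F`-bilinear map
`V × V → V[λ]` satisfying sesquilinearity and the Leibniz rules. -/
structure LambdaBracket (D : Derivation F V V) where
  /-- the bracket `{a_λ b}` -/
  br : V →ₗ[F] V →ₗ[F] V[X]
  sesq_left : ∀ a b, br (D a) b = -(X * br a b)
  sesq_right : ∀ a b, br a (D b) = lamAdd D (br a b)
  leibniz_left : ∀ a b c, br a (b * c) = br a b * C c + br a c * C b
  leibniz_right : ∀ a b c, br (a * b) c = shiftEval D (br a c) b + shiftEval D (br b c) a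

theorem shiftEval_neg (D : Derivation F V V) (P : V[X]) (b : V) :
    shiftEval D (-P) b = -shiftEval D P b := by
  simp [shiftEval, Polynomial.sum_def, Finset.sum_neg_distrib]

/-- The opposite `λ`-bracket `-{·_λ ·}`. -/
def LambdaBracket.opposite {D : Derivation F V V} (L : LambdaBracket D) : LambdaBracket D where
  br := -L.br
  sesq_left a b := by simp [L.sesq_left]
  sesq_right a b := by simp [L.sesq_right]
  leibniz_left a b c := by simp [L.leibniz_left]; ring
  leibniz_right a b c := by simp [L.leibniz_right, shiftEval_neg]; ring

/-! ### Operators of Adler type -/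

/-- The series `B(λ - z) = ∑ₘ bₘ (λ - z)ᵐ ∈ V[λ]((z⁻¹))`, where
`(λ - z)ᵐ = ∑_{l ≥ 0} (m choose l) λˡ (-z)^(m-l)`. -/
def lamSub (b : PDO V) : ℤ → V[X] := fun s =>
  ∑ᶠ l : ℕ, (s.negOnePow : ℤ) • (Ring.choose (s + l) l • (C (b.1 (s + l)) * X ^ l))

/-- A series in `z`, as a series in `z` and `w`. -/
def inZ {W : Type*} [Zero W] (g : ℤ → W) : ℤ → ℤ → W := fun p q => if q = 0 then g p else 0

/-- A series in `w`, as a series in `z` and `w`. -/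
def inW {W : Type*} [Zero W] (g : ℤ → W) : ℤ → ℤ → W := fun p q => if p = 0 then g q else 0

/-- For scalar operators `a`, `b`, the series
`a(w+λ+∂) ι_z(z-w-λ-∂)⁻¹ b*(λ-z) - a(z) ι_z(z-w-λ-∂)⁻¹ b(w)`
in `z, w` with coefficients in `V[λ]`. -/
def adlerRHS (D : Derivation F V V) (a b : PDO V) : ℤ → ℤ → V[X] := fun p q =>
  shiftApply (lamAdd D) a.1
      (iotaInv (lamAdd D) (inZ (lamSub (PDO.adjoint D b))) p) q
    - mulZ a.1 (iotaInv (lamAdd D) (inW fun r => C (b.1 r))) p q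

/-- For scalar operators `a`, `b`, the series `{a(z)_λ b(w)} = ∑ₚ,ᵩ {aₚ _λ bᵩ} z^p w^q`. -/
def LambdaBracket.series {D : Derivation F V V} (L : LambdaBracket D) (a b : PDO V) :
    ℤ → ℤ → V[X] := fun p q =>
  L.br (a.1 p) (b.1 q)

/-- A matrix pseudodifferential operator `A` is of Adler type with respect to the `λ`-bracket `L` if
`{Aᵢⱼ(z)_λ Aₕₖ(w)} = Aₕⱼ(w+λ+∂) ι_z(z-w-λ-∂)⁻¹ (Aᵢₖ)*(λ-z) - Aₕⱼ(z) ι_z(z-w-λ-∂)⁻¹ Aᵢₖ(w)`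
for all `i, j, h, k`. -/
def IsAdler {m n : Type*} {D : Derivation F V V} (L : LambdaBracket D)
    (A : Matrix m n (PDO V)) : Prop :=
  ∀ (i : m) (j : n) (h : m) (k : n),
    L.series (A i j) (A h k) = adlerRHS D (A h j) (A i k)

end Diff

end AdlerType

end

/-!
Both sides of the Adler identity are series in `z` and `w` with coefficients in `V[λ]`, and
operators act on such series from the left and from the right, in each of the two variables.  In `w`
the derivation of the coefficients is `λ + ∂`; in `z` it is `-λ`, with `v ∈ V` acting by
`P(λ) ↦ P(λ + x)(|_{x=∂} v)`.  The sesquilinearity and Leibniz rules say exactly that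
`{a(z)_λ b(w)}` is a biderivation for these actions, and with `φ = ι_z (z - w - λ - ∂)⁻¹` the Adler
identity becomes

`{Aᵢⱼ, Aₕₖ} = Aₕⱼ ·_w (Aᵢₖ ·_z φ) - (φ ·_w Aᵢₖ) ·_z Aₕⱼ`.

Since all these actions commute, the statements about products and inverses are formal.  Taking
adjoints in both variables exchanges left and right actions and sends `φ` to `-φ`, whence the
statement about the formal adjoint.
-/

noncomputable section

namespace AdlerType

theorem eq_of_injective_rec {X : Type*} {Φ : X → X} (hΦ : Φ.Injective) {f g : ℤ → X}
    (h0 : f 0 = g 0) (hf : ∀ n, f (n + 1) = Φ (f n)) (hg : ∀ n, g (n + 1) = Φ (g n)) (n : ℤ) :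
    f n = g n := by
  induction n using Int.induction_on with
  | zero => exact h0
  | succ n ih => rw [hf, hg, ih]
  | pred n ih =>
    apply hΦ
    rw [← hf, ← hg, sub_add_cancel, ih]

/-! ### Laurent series with coefficients in a group -/

/-- The series `∑ₙ fₙ zⁿ` with coefficients in `W` and `fₙ = 0` for large `n`, as families of
coefficients. -/
def laurentSubgroup (W : Type*) [AddCommGroup W] : AddSubgroup (ℤ → W) where
  carrier := {f | ∃ N : ℤ, ∀ n, N < n → f n = 0}
  zero_mem' := ⟨0, fun _ _ => rfl⟩
  add_mem' := by
    rintro f g ⟨N, hN⟩ ⟨M, hM⟩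
    exact ⟨max N M, fun n hn => by simp [hN n (by omega), hM n (by omega)]⟩
  neg_mem' := by
    rintro f ⟨N, hN⟩
    exact ⟨N, fun n hn => by simp [hN n hn]⟩

/-- The group `W((z⁻¹))` of formal Laurent series in `z⁻¹`. -/
def Laurent (W : Type*) [AddCommGroup W] : Type _ := laurentSubgroup W

namespace Laurent

section Basic

variable {A B C W W' : Type*} [AddCommGroup A] [AddCommGroup B] [AddCommGroup C]
  [AddCommGroup W] [AddCommGroup W']

instance : AddCommGroup (Laurent W) := inferInstanceAs (AddCommGroup (laurentSubgroup W))

instance : FunLike (Laurent W) ℤ W := ⟨Subtype.val, Subtype.val_injective⟩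

/-- The series with the given coefficients. -/
def ofFun (f : ℤ → W) (h : ∃ N : ℤ, ∀ n, N < n → f n = 0) : Laurent W := ⟨f, h⟩

@[simp] theorem ofFun_apply (f : ℤ → W) (h) (n : ℤ) : ofFun f h n = f n := rfl

@[ext] theorem ext {f g : Laurent W} (h : ∀ n, f n = g n) : f = g := DFunLike.ext f g h

@[simp] theorem add_apply (f g : Laurent W) (n : ℤ) : (f + g) n = f n + g n := rfl

@[simp] theorem neg_apply (f : Laurent W) (n : ℤ) : (-f) n = -f n := rfl

@[simp] theorem sub_apply (f g : Laurent W) (n : ℤ) : (f - g) n = f n - g n := rfl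

/-- The coefficient of `zⁿ`, as an additive map. -/
def coeff (n : ℤ) : Laurent W →+ W := AddMonoidHom.mk' (fun f => f n) fun _ _ => rfl

theorem finsum_apply {ι : Type*} {f : ι → Laurent W} (hf : f.HasFiniteSupport) (n : ℤ) :
    (∑ᶠ i, f i) n = ∑ᶠ i, f i n :=
  (coeff n).map_finsum hf

@[simp] theorem sum_apply {ι : Type*} (s : Finset ι) (f : ι → Laurent W) (n : ℤ) :
    (∑ i ∈ s, f i) n = ∑ i ∈ s, f i n :=
  map_sum (coeff n) f s

/-- The degree of `f` in `z` is at most `N`. -/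
def DegLE (f : Laurent W) (N : ℤ) : Prop := ∀ n, N < n → f n = 0

theorem exists_degLE (f : Laurent W) : ∃ N, f.DegLE N := f.2

theorem DegLE.mono {f : Laurent W} {N M : ℤ} (hf : f.DegLE N) (h : N ≤ M) : f.DegLE M :=
  fun n hn => hf n (h.trans_lt hn)

/-- The monomial `e zⁿ`. -/
def single (n : ℤ) : W →+ Laurent W :=
  AddMonoidHom.mk' (fun e => ofFun (fun m => if m = n then e else 0)
    ⟨n, fun _ hm => if_neg hm.ne'⟩) fun e e' => ext fun m => by
      simp only [ofFun_apply, add_apply]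
      split_ifs <;> simp

theorem single_apply (n : ℤ) (e : W) (m : ℤ) : single n e m = if m = n then e else 0 := rfl

@[simp] theorem single_apply_same (n : ℤ) (e : W) : single n e n = e := if_pos rfl

theorem single_apply_of_ne {m n : ℤ} (h : m ≠ n) (e : W) : single n e m = 0 := if_neg h

/-- Multiplication by `z`. -/
def zMul : Laurent W →+ Laurent W :=
  AddMonoidHom.mk' (fun f => ofFun (fun n => f (n - 1)) <| by
    obtain ⟨N, hN⟩ := f.exists_degLE
    exact ⟨N + 1, fun n hn => hN _ (by omega)⟩) fun _ _ => rfl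

@[simp] theorem zMul_apply (f : Laurent W) (n : ℤ) : zMul f n = f (n - 1) := rfl

theorem zMul_single (n : ℤ) (e : W) : zMul (single n e) = single (n + 1) e := by
  ext m
  simp only [zMul_apply, single_apply, sub_eq_iff_eq_add]

/-- An additive map applied to all coefficients. -/
def map : (W →+ W') →+ Laurent W →+ Laurent W' :=
  AddMonoidHom.mk' (fun η => AddMonoidHom.mk' (fun f => ofFun (fun n => η (f n)) <| by
      obtain ⟨N, hN⟩ := f.exists_degLE
      exact ⟨N, fun n hn => by rw [hN n hn, map_zero]⟩)
    fun f g => ext fun n => map_add η (f n) (g n)) fun _ _ => rfl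

@[simp] theorem map_apply (η : W →+ W') (f : Laurent W) (n : ℤ) : map η f n = η (f n) := rfl

@[simp] theorem map_single (η : W →+ W') (n : ℤ) (e : W) :
    map η (single n e) = single n (η e) := by
  ext m
  simp only [map_apply, single_apply, apply_ite η, map_zero]

/-! ### Bounded maps -/

/-- An additive map between groups of series that raises degrees by a bounded amount. -/
def IsBounded (F : Laurent W →+ Laurent W') : Prop :=
  ∃ c : ℤ, ∀ f N, f.DegLE N → (F f).DegLE (N + c)

namespace IsBounded

theorem id : IsBounded (AddMonoidHom.id (Laurent W)) := ⟨0, fun _ _ h => h.mono (by simp)⟩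

theorem comp {F : Laurent B →+ Laurent C} {G : Laurent A →+ Laurent B} (hF : IsBounded F)
    (hG : IsBounded G) : IsBounded (F.comp G) := by
  obtain ⟨c, hc⟩ := hF
  obtain ⟨d, hd⟩ := hG
  exact ⟨d + c, fun f N h => (hc _ _ (hd f N h)).mono (add_assoc N d c).le⟩

theorem map (η : W →+ W') : IsBounded (map η) :=
  ⟨0, fun f N h n hn => by rw [map_apply, h n (by omega), map_zero]⟩

/-- Up to degrees that a bounded map cannot bring above `q`, a series is a finite sum of
monomials. -/
theorem eq_zero {F : Laurent W →+ Laurent W'} (hF : IsBounded F)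
    (h : ∀ n e, F (single n e) = 0) : F = 0 := by
  obtain ⟨c, hc⟩ := hF
  ext f q
  obtain ⟨N, hN⟩ := f.exists_degLE
  let P : Laurent W := ∑ n ∈ Finset.Icc (q - c) N, single n (f n)
  have hrest : (f - P).DegLE (q - c - 1) := by
    intro n hn
    simp only [P, sub_apply, sum_apply, single_apply, Finset.sum_ite_eq, Finset.mem_Icc]
    split_ifs with h1
    · exact sub_self _
    · rw [hN n (by omega), sub_zero]
  have hP : F P = 0 := by
    rw [map_sum]
    exact Finset.sum_eq_zero fun n _ => h n _
  rw [← sub_add_cancel f P, map_add, hP, add_zero]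
  exact hc _ _ hrest q (by omega)

theorem ext {F G : Laurent W →+ Laurent W'} (hF : IsBounded F) (hG : IsBounded G)
    (h : ∀ n e, F (single n e) = G (single n e)) : F = G := by
  obtain ⟨c, hc⟩ := hF
  obtain ⟨d, hd⟩ := hG
  refine sub_eq_zero.1 (eq_zero ⟨max c d, fun f N hf n hn => ?_⟩ fun n e => ?_)
  · rw [AddMonoidHom.sub_apply, sub_apply, hc f N hf n (by omega), hd f N hf n (by omega),
      sub_zero]
  · rw [AddMonoidHom.sub_apply, h, sub_self]

theorem neg {F : Laurent W →+ Laurent W'} (hF : IsBounded F) : IsBounded (-F) := by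
  obtain ⟨c, hc⟩ := hF
  exact ⟨c, fun f N hf n hn => by rw [AddMonoidHom.neg_apply, neg_apply, hc f N hf n hn, neg_zero]⟩

theorem zMul : IsBounded (zMul : Laurent W →+ Laurent W) :=
  ⟨1, fun f N h n hn => h _ (by omega)⟩

end IsBounded

/-! ### Powers of `z + T` -/

/-- The operator `z + T`. -/
def zAdd (T : W →+ W) : Laurent W →+ Laurent W := zMul + map T

@[simp] theorem zAdd_apply (T : W →+ W) (f : Laurent W) (n : ℤ) :
    zAdd T f n = f (n - 1) + T (f n) := rfl

theorem zAdd_eq (T : W →+ W) (f : Laurent W) : zAdd T f = zMul f + map T f := rfl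

theorem IsBounded.zAdd (T : W →+ W) : IsBounded (zAdd T) :=
  ⟨1, fun f N h n hn => by rw [zAdd_apply, h _ (by omega), h n (by omega), map_zero, add_zero]⟩

theorem zMul_injective : Function.Injective (zMul : Laurent W →+ Laurent W) := by
  intro f g h
  ext n
  simpa only [zMul_apply, add_sub_cancel_right] using DFunLike.congr_fun h (n + 1)

theorem zAdd_injective (T : W →+ W) : Function.Injective (zAdd T) := by
  rw [injective_iff_map_eq_zero]
  intro f hf
  obtain ⟨N, hN⟩ := f.exists_degLE
  have descend : ∀ k : ℕ, f.DegLE (N - k) := by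
    intro k
    induction k with
    | zero => simpa using hN
    | succ k ih =>
      intro n hn
      have h := DFunLike.congr_fun hf (n + 1)
      rwa [zAdd_apply, ih (n + 1) (by push_cast at hn; omega), map_zero, add_zero,
        add_sub_cancel_right] at h
  ext n
  exact descend (N - n + 1).toNat n (by omega)

theorem finsum_choose_eq_sum (T : W →+ W) (n : ℤ) {f : Laurent W} {N : ℤ}
    (hN : f.DegLE N) {q : ℤ} {M : ℕ} (hM : N < q - n + M) :
    ∑ᶠ k : ℕ, Ring.choose n k • T^[k] (f (q - n + k)) =
      ∑ k ∈ Finset.range M, Ring.choose n k • T^[k] (f (q - n + k)) := by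
  refine finsum_eq_sum_of_support_subset _ fun k hk => ?_
  by_contra hkM
  simp only [Finset.coe_range, Set.mem_Iio, not_lt] at hkM
  exact hk (by simp [hN (q - n + k) (by omega)])

theorem hasFiniteSupport_add_nat (f : Laurent W) {φ : ℕ → W → W'}
    (hφ : ∀ k, φ k 0 = 0) (c : ℤ) : (fun k : ℕ => φ k (f (c + k))).HasFiniteSupport := by
  obtain ⟨N, hN⟩ := f.exists_degLE
  refine (Set.finite_le_nat (N - c).toNat).subset fun k hk => ?_
  by_contra hkN
  rw [Set.mem_ofPred_eq] at hkN
  exact hk (by simp only [hN (c + k) (by omega), hφ])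

/-- The operator `(z + T)ⁿ`, expanded in non-negative powers of `T`. -/
def shiftPow (T : W →+ W) (n : ℤ) : Laurent W →+ Laurent W :=
  AddMonoidHom.mk'
    (fun f => ofFun (fun q => ∑ᶠ k : ℕ, Ring.choose n k • T^[k] (f (q - n + k))) <| by
      obtain ⟨N, hN⟩ := f.exists_degLE
      exact ⟨N + n, fun q hq => by
        rw [finsum_choose_eq_sum T n hN (M := 0) (by push_cast; omega), Finset.sum_range_zero]⟩)
    fun f g => by
      have hfin (f : Laurent W) (q : ℤ) :=
        hasFiniteSupport_add_nat f (φ := fun k x => Ring.choose n k • T^[k] x)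
          (fun k => by rw [iterate_map_zero, smul_zero]) (q - n)
      ext q
      simp only [ofFun_apply, add_apply, iterate_map_add, smul_add]
      exact finsum_add_distrib (hfin f q) (hfin g q)

theorem shiftPow_apply (T : W →+ W) (n : ℤ) (f : Laurent W) (q : ℤ) :
    shiftPow T n f q = ∑ᶠ k : ℕ, Ring.choose n k • T^[k] (f (q - n + k)) := rfl

theorem DegLE.shiftPow {f : Laurent W} {N : ℤ} (hN : f.DegLE N) (T : W →+ W) (n : ℤ) :
    (shiftPow T n f).DegLE (n + N) := fun q hq => by
  rw [shiftPow_apply, finsum_choose_eq_sum T n hN (M := 0) (by push_cast; omega),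
    Finset.sum_range_zero]

theorem shiftPow_zero (T : W →+ W) (f : Laurent W) : shiftPow T 0 f = f := by
  ext q
  rw [shiftPow_apply, finsum_eq_single _ 0]
  · simp
  · intro k hk
    rw [Ring.choose_zero_pos ℤ (Nat.pos_of_ne_zero hk), zero_smul]

theorem shiftPow_add_one (T : W →+ W) (n : ℤ) (f : Laurent W) :
    shiftPow T (n + 1) f = zAdd T (shiftPow T n f) := by
  ext q
  obtain ⟨N, hN⟩ := f.exists_degLE
  set M := (N - (q - n) + 1).toNat
  rw [zAdd_apply, shiftPow_apply, shiftPow_apply, shiftPow_apply,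
    finsum_choose_eq_sum T (n + 1) hN (M := M + 1) (by push_cast; omega),
    finsum_choose_eq_sum T n hN (q := q - 1) (M := M + 1) (by push_cast; omega),
    finsum_choose_eq_sum T n hN (q := q) (M := M) (by omega), Finset.sum_range_succ',
    Finset.sum_range_succ', map_sum, add_right_comm, ← Finset.sum_add_distrib]
  congr 1
  · refine Finset.sum_congr rfl fun k _ => ?_
    rw [show q - (n + 1) + (k + 1 : ℕ) = q - n + k by push_cast; ring,
      show q - 1 - n + (k + 1 : ℕ) = q - n + k by push_cast; ring, Ring.choose_succ_succ,
      map_zsmul, add_smul, add_comm, Function.iterate_succ_apply']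
  · rw [show q - (n + 1) + (0 : ℕ) = q - 1 - n + (0 : ℕ) by ring, Ring.choose_zero_right,
      Ring.choose_zero_right]

theorem eq_shiftPow (T : W →+ W) {f : ℤ → Laurent W}
    (hf : ∀ n, f (n + 1) = zAdd T (f n)) (n : ℤ) : f n = shiftPow T n (f 0) :=
  eq_of_injective_rec (zAdd_injective T) (g := fun n => shiftPow T n (f 0))
    (shiftPow_zero T _).symm hf (fun n => shiftPow_add_one T n _) n

theorem zAdd_shiftPow_neg_one (T : W →+ W) (f : Laurent W) :
    zAdd T (shiftPow T (-1) f) = f := by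
  rw [← shiftPow_add_one, neg_add_cancel, shiftPow_zero]

theorem shiftPow_comm {T : W →+ W} {T' : W' →+ W'}
    {Φ : Laurent W → Laurent W'} (h : ∀ f, Φ (zAdd T f) = zAdd T' (Φ f)) (n : ℤ) (f : Laurent W) :
    Φ (shiftPow T n f) = shiftPow T' n (Φ f) := by
  have hrec := eq_shiftPow T' (f := fun n => Φ (shiftPow T n f))
    (fun n => by rw [shiftPow_add_one, h]) n
  simpa only [shiftPow_zero] using hrec

theorem shiftPow_zAdd (T : W →+ W) (n : ℤ) (f : Laurent W) :
    shiftPow T n (zAdd T f) = shiftPow T (n + 1) f := by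
  rw [shiftPow_add_one, shiftPow_comm (Φ := zAdd T) fun _ => rfl]

theorem map_zAdd {T : W →+ W} {T' : W' →+ W'} {η : W →+ W'}
    (h : ∀ x, η (T x) = T' (η x)) (f : Laurent W) : map η (zAdd T f) = zAdd T' (map η f) := by
  ext q
  simp only [map_apply, zAdd_apply, map_add, h]

theorem map_shiftPow {T : W →+ W} {T' : W' →+ W'} {η : W →+ W'}
    (h : ∀ x, η (T x) = T' (η x)) (n : ℤ) (f : Laurent W) :
    map η (shiftPow T n f) = shiftPow T' n (map η f) :=
  shiftPow_comm (map_zAdd h) n f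

theorem shiftPow_single_zero {T : W →+ W} {e : W} (he : T e = 0) (n : ℤ) :
    shiftPow T n (single 0 e) = single n e :=
  (eq_shiftPow T (f := fun n => single n e) (fun n => by
    rw [zAdd_eq, zMul_single, map_single, he, map_zero, add_zero]) n).symm

end Basic

/-! ### Products with a shifted variable -/

section ShiftMul

variable {A B C A' B' C' X Y Z : Type*} [AddCommGroup A] [AddCommGroup B] [AddCommGroup C]
  [AddCommGroup A'] [AddCommGroup B'] [AddCommGroup C'] [AddCommGroup X] [AddCommGroup Y]
  [AddCommGroup Z]

theorem hasFiniteSupport_shiftMul (β : A →+ B →+ C) (T : B →+ B) (a : Laurent A)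
    (b : Laurent B) (q : ℤ) :
    (fun n : ℤ => β (a n) (shiftPow T n b q)).HasFiniteSupport := by
  obtain ⟨N, hN⟩ := a.exists_degLE
  obtain ⟨M, hM⟩ := b.exists_degLE
  refine (Set.finite_Icc (q - M) N).subset fun n hn => ?_
  by_contra h
  refine hn ?_
  rw [Set.mem_Icc, not_and_or, not_le, not_le] at h
  rcases h with h | h
  · simp only [hM.shiftPow T n q (by omega), map_zero]
  · simp only [hN n h, map_zero, AddMonoidHom.zero_apply]

theorem finsum_shiftMul_eq_zero (β : A →+ B →+ C) (T : B →+ B) {a : Laurent A}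
    {b : Laurent B} {N M : ℤ} (hN : a.DegLE N) (hM : b.DegLE M) {q : ℤ} (hq : N + M < q) :
    ∑ᶠ n : ℤ, β (a n) (shiftPow T n b q) = 0 := by
  refine (finsum_congr fun n => ?_).trans finsum_zero
  rcases lt_or_ge N n with h | h
  · rw [hN n h, map_zero, AddMonoidHom.zero_apply]
  · rw [hM.shiftPow T n q (by omega), map_zero]

/-- The product `a(z + T) b(z) = ∑ₙ aₙ (z + T)ⁿ b(z)`, where the coefficients are multiplied
by the biadditive map `β`. -/
def shiftMul (β : A →+ B →+ C) (T : B →+ B) : Laurent A →+ Laurent B →+ Laurent C :=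
  AddMonoidHom.mk' (fun a => AddMonoidHom.mk'
      (fun b => ofFun (fun q => ∑ᶠ n : ℤ, β (a n) (shiftPow T n b q)) <| by
        obtain ⟨N, hN⟩ := a.exists_degLE
        obtain ⟨M, hM⟩ := b.exists_degLE
        exact ⟨N + M, fun q hq => finsum_shiftMul_eq_zero β T hN hM hq⟩)
      fun b b' => by
        ext q
        simp only [ofFun_apply, map_add, add_apply]
        exact finsum_add_distrib (hasFiniteSupport_shiftMul β T a b q)
          (hasFiniteSupport_shiftMul β T a b' q))
    fun a a' => by
      ext b q
      simp only [AddMonoidHom.mk'_apply, AddMonoidHom.add_apply, ofFun_apply, map_add, add_apply]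
      exact finsum_add_distrib (hasFiniteSupport_shiftMul β T a b q)
        (hasFiniteSupport_shiftMul β T a' b q)

theorem shiftMul_apply (β : A →+ B →+ C) (T : B →+ B) (a : Laurent A) (b : Laurent B)
    (q : ℤ) : shiftMul β T a b q = ∑ᶠ n : ℤ, β (a n) (shiftPow T n b q) := rfl

theorem DegLE.shiftMul {a : Laurent A} {b : Laurent B} {N M : ℤ} (hN : a.DegLE N)
    (hM : b.DegLE M) (β : A →+ B →+ C) (T : B →+ B) :
    (shiftMul β T a b).DegLE (N + M) :=
  fun _ hq => finsum_shiftMul_eq_zero β T hN hM hq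

namespace IsBounded

theorem shiftMul (β : A →+ B →+ C) (T : B →+ B) (a : Laurent A) :
    IsBounded (shiftMul β T a) := by
  obtain ⟨N, hN⟩ := a.exists_degLE
  exact ⟨N, fun b M hM => (hN.shiftMul hM β T).mono (add_comm N M).le⟩

theorem shiftMul_flip (β : A →+ B →+ C) (T : B →+ B) (b : Laurent B) :
    IsBounded ((Laurent.shiftMul β T).flip b) := by
  obtain ⟨M, hM⟩ := b.exists_degLE
  exact ⟨M, fun a N hN => hN.shiftMul hM β T⟩

end IsBounded

theorem shiftMul_single (β : A →+ B →+ C) (T : B →+ B) (n : ℤ) (e : A)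
    (b : Laurent B) : shiftMul β T (single n e) b = map (β e) (shiftPow T n b) := by
  ext q
  rw [shiftMul_apply, finsum_eq_single _ n fun m hm => by
    rw [single_apply_of_ne hm, map_zero, AddMonoidHom.zero_apply], single_apply_same, map_apply]

theorem shiftMul_single_zero_right (β : A →+ B →+ C) {T : B →+ B} {e : B}
    (he : T e = 0) (a : Laurent A) : shiftMul β T a (single 0 e) = map (β.flip e) a := by
  ext q
  rw [shiftMul_apply, finsum_eq_single _ q fun n hn => by
    rw [shiftPow_single_zero he, single_apply_of_ne hn.symm, map_zero], shiftPow_single_zero he,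
    single_apply_same, map_apply, AddMonoidHom.flip_apply]

theorem shiftMul_zMul_left (β : A →+ B →+ C) (T : B →+ B) (a : Laurent A)
    (b : Laurent B) : shiftMul β T (zMul a) b = shiftMul β T a (zAdd T b) := by
  ext q
  simp only [shiftMul_apply, zMul_apply, shiftPow_zAdd]
  rw [← finsum_comp_equiv (Equiv.addRight (1 : ℤ))]
  simp only [Equiv.coe_addRight, add_sub_cancel_right]

theorem shiftMul_zMul_right (β : A →+ B →+ C) (T : B →+ B) (a : Laurent A)
    (b : Laurent B) : shiftMul β T a (zMul b) = zMul (shiftMul β T a b) := by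
  have hcomm (n : ℤ) : shiftPow T n (zMul b) = zMul (shiftPow T n b) :=
    (shiftPow_comm (Φ := zMul) (fun f => by rw [zAdd_eq, map_add]; rfl) n b).symm
  ext q
  simp only [shiftMul_apply, zMul_apply, hcomm]

theorem map_shiftMul {β : A →+ B →+ C} {β' : A' →+ B' →+ C'} {T : B →+ B}
    {T' : B' →+ B'} {γ : C →+ C'} {α : A →+ A'} {η : B →+ B'}
    (h : ∀ a b, γ (β a b) = β' (α a) (η b)) (hT : ∀ b, η (T b) = T' (η b)) (a : Laurent A)
    (b : Laurent B) :
    map γ (shiftMul β T a b) = shiftMul β' T' (map α a) (map η b) := by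
  ext q
  rw [map_apply, shiftMul_apply, shiftMul_apply,
    γ.map_finsum (hasFiniteSupport_shiftMul β T a b q)]
  simp only [h, map_apply, ← map_shiftPow hT]

theorem map_shiftMul_of_leibniz {β : A →+ B →+ C} {β₁ : A' →+ B →+ C'} {β₂ : A →+ B' →+ C'}
    {T : B →+ B} {T' : B' →+ B'} {δ : C →+ C'} {α : A →+ A'} {η : B →+ B'}
    (h : ∀ a b, δ (β a b) = β₁ (α a) b + β₂ a (η b)) (hT : ∀ b, η (T b) = T' (η b))
    (a : Laurent A) (b : Laurent B) :
    map δ (shiftMul β T a b) = shiftMul β₁ T (map α a) b + shiftMul β₂ T' a (map η b) := by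
  ext q
  rw [map_apply, add_apply, shiftMul_apply, shiftMul_apply, shiftMul_apply,
    δ.map_finsum (hasFiniteSupport_shiftMul β T a b q),
    ← finsum_add_distrib (hasFiniteSupport_shiftMul β₁ T _ b q)
      (hasFiniteSupport_shiftMul β₂ T' a _ q)]
  simp only [h, map_apply, ← map_shiftPow hT]

theorem zAdd_shiftMul {β : A →+ B →+ C} {TA : A →+ A} {TB : B →+ B}
    {TC : C →+ C} (h : ∀ a b, TC (β a b) = β (TA a) b + β a (TB b)) (a : Laurent A)
    (b : Laurent B) : zAdd TC (shiftMul β TB a b) = shiftMul β TB (zAdd TA a) b := by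
  have hmap := map_shiftMul_of_leibniz (δ := TC) (α := TA) (η := TB) h (fun _ => rfl) a b
  rw [zAdd_eq, hmap, zAdd_eq TA, map_add, AddMonoidHom.add_apply, shiftMul_zMul_left, zAdd_eq,
    map_add, shiftMul_zMul_right, add_assoc, add_comm (shiftMul β TB a _)]

theorem shiftMul_assoc {β : A →+ B →+ C} {γ : C →+ X →+ Z} {γ' : B →+ X →+ Y}
    {β' : A →+ Y →+ Z} {TB : B →+ B} {TX : X →+ X} {TY : Y →+ Y}
    (h : ∀ a b x, γ (β a b) x = β' a (γ' b x))
    (hT : ∀ b x, TY (γ' b x) = γ' (TB b) x + γ' b (TX x))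
    (a : Laurent A) (b : Laurent B) (x : Laurent X) :
    shiftMul γ TX (shiftMul β TB a b) x = shiftMul β' TY a (shiftMul γ' TX b x) := by
  refine DFunLike.congr_fun (IsBounded.ext
    (F := ((shiftMul γ TX).flip x).comp ((shiftMul β TB).flip b))
    (G := (shiftMul β' TY).flip (shiftMul γ' TX b x))
    ((IsBounded.shiftMul_flip γ TX x).comp (.shiftMul_flip β TB b))
    (.shiftMul_flip β' TY _) fun n e => ?_) a
  simp only [AddMonoidHom.comp_apply, AddMonoidHom.flip_apply, shiftMul_single]
  rw [← shiftPow_comm (Φ := fun b => shiftMul γ' TX b x) fun f => (zAdd_shiftMul hT f x).symm]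
  have hmap := map_shiftMul (T := TX) (T' := TX) (γ := β' e) (α := β e) (η := .id X)
    (fun b x => (h e b x).symm) (fun _ => rfl) (shiftPow TB n b) x
  exact hmap.symm

end ShiftMul

/-! ### The substitution of `-z - T` for `z` -/

section Reflect

variable {A B W W' : Type*} [AddCommGroup A] [AddCommGroup B] [AddCommGroup W] [AddCommGroup W']

/-- The substitution `f(z) ↦ f(-z - T) = ∑ₙ (-z - T)ⁿ fₙ`, with powers expanded in non-negative
powers of `T`. -/
def reflect (T : W →+ W) : Laurent W →+ Laurent W :=
  AddMonoidHom.mk'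
    (fun f => ofFun
      (fun s => ∑ᶠ k : ℕ, ((s + k).negOnePow : ℤ) • Ring.choose (s + k) k • T^[k] (f (s + k))) <| by
      obtain ⟨N, hN⟩ := f.exists_degLE
      refine ⟨N, fun s hs => (finsum_congr fun k => ?_).trans finsum_zero⟩
      rw [hN (s + k) (by omega), iterate_map_zero, smul_zero, smul_zero])
    fun f g => by
      have hfin (f : Laurent W) (s : ℤ) := hasFiniteSupport_add_nat f
        (φ := fun k x => ((s + k).negOnePow : ℤ) • Ring.choose (s + k) k • T^[k] x)
        (fun k => by rw [iterate_map_zero, smul_zero, smul_zero]) s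
      ext s
      simp only [ofFun_apply, add_apply, iterate_map_add, smul_add]
      exact finsum_add_distrib (hfin f s) (hfin g s)

theorem reflect_apply (T : W →+ W) (f : Laurent W) (s : ℤ) :
    reflect T f s =
      ∑ᶠ k : ℕ, ((s + k).negOnePow : ℤ) • Ring.choose (s + k) k • T^[k] (f (s + k)) := rfl

theorem IsBounded.reflect (T : W →+ W) : IsBounded (reflect T) := by
  refine ⟨0, fun f N hN s hs => (finsum_congr fun k => ?_).trans finsum_zero⟩
  rw [hN (s + k) (by omega), iterate_map_zero, smul_zero, smul_zero]

theorem reflect_single (T : W →+ W) (n : ℤ) (e : W) :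
    reflect T (single n e) = (n.negOnePow : ℤ) • shiftPow T n (single 0 e) := by
  refine ext fun s => ?_
  change _ = (DistribSMul.toAddMonoidHom W (n.negOnePow : ℤ)) (shiftPow T n (single 0 e) s)
  rw [reflect_apply, shiftPow_apply, AddMonoidHom.map_finsum _
    (hasFiniteSupport_add_nat (single 0 e) (φ := fun k x => Ring.choose n k • T^[k] x)
      (fun k => by rw [iterate_map_zero, smul_zero]) (s - n))]
  refine finsum_congr fun k => ?_
  rcases eq_or_ne (s + k) n with h | h
  · rw [h, show s - n + k = 0 by omega, single_apply_same, single_apply_same]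
    rfl
  · rw [single_apply_of_ne h, single_apply_of_ne (by omega : s - n + k ≠ 0), iterate_map_zero,
      smul_zero, smul_zero, smul_zero, map_zero]

theorem reflect_single_zero (T : W →+ W) (e : W) : reflect T (single 0 e) = single 0 e := by
  rw [reflect_single, shiftPow_zero, Int.negOnePow_zero, Units.val_one, one_smul]

theorem reflect_zMul (T : W →+ W) (f : Laurent W) :
    reflect T (zMul f) = -zAdd T (reflect T f) := by
  refine DFunLike.congr_fun (IsBounded.ext (F := (reflect T).comp zMul)
    (G := -(zAdd T).comp (reflect T)) ((IsBounded.reflect T).comp .zMul)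
    ((IsBounded.zAdd T).comp (.reflect T)).neg fun n e => ?_) f
  rw [AddMonoidHom.comp_apply, AddMonoidHom.neg_apply, AddMonoidHom.comp_apply, zMul_single,
    reflect_single, reflect_single, shiftPow_add_one, map_zsmul, Int.negOnePow_succ,
    Units.val_neg, neg_smul]

theorem map_reflect {T : W →+ W} {T' : W' →+ W'} {η : W →+ W'} (h : ∀ x, η (T x) = T' (η x))
    (f : Laurent W) : map η (reflect T f) = reflect T' (map η f) := by
  refine DFunLike.congr_fun (IsBounded.ext (F := (map η).comp (reflect T))
    (G := (reflect T').comp (map η)) ((IsBounded.map η).comp (.reflect T))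
    ((IsBounded.reflect T').comp (.map η)) fun n e => ?_) f
  rw [AddMonoidHom.comp_apply, AddMonoidHom.comp_apply, map_single, reflect_single,
    reflect_single, map_zsmul, map_shiftPow h, map_single]

theorem reflect_zAdd (T : W →+ W) (f : Laurent W) : reflect T (zAdd T f) = -zMul (reflect T f) := by
  rw [zAdd_eq, map_add, reflect_zMul, ← map_reflect (η := T) fun _ => rfl, zAdd_eq]
  abel

theorem reflect_reflect (T : W →+ W) (f : Laurent W) : reflect T (reflect T f) = f := by
  refine DFunLike.congr_fun (IsBounded.ext (F := (reflect T).comp (reflect T)) (G := .id _)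
    ((IsBounded.reflect T).comp (.reflect T)) .id fun n e => ?_) f
  refine eq_of_injective_rec zMul_injective (f := fun n => reflect T (reflect T (single n e)))
    (g := fun n => single n e) ?_ (fun n => ?_) (fun n => (zMul_single n e).symm) n
  · simp only [reflect_single_zero]
  · simp only [← zMul_single, reflect_zMul, map_neg, reflect_zAdd, neg_neg]

theorem reflect_map {β : A →+ W →+ W} {T : A →+ A} {T' : W →+ W}
    (h : ∀ a x, T' (β a x) = β a (T' x) + β (T a) x) (a : A) (f : Laurent W) :
    reflect T' (map (β a) f) = shiftMul β.flip T (reflect T' f) (single 0 a) := by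
  refine DFunLike.congr_fun (IsBounded.ext (F := (reflect T').comp (map (β a)))
    (G := ((shiftMul β.flip T).flip (single 0 a)).comp (reflect T'))
    ((IsBounded.reflect T').comp (.map _))
    ((IsBounded.shiftMul_flip _ _ _).comp (.reflect T')) fun n e => ?_) f
  refine eq_of_injective_rec (Φ := -zAdd T') (neg_injective.comp (zAdd_injective T'))
    (f := fun n => reflect T' (map (β a) (single n e)))
    (g := fun n => shiftMul β.flip T (reflect T' (single n e)) (single 0 a)) ?_
    (fun n => ?_) (fun n => ?_) n
  · simp only [map_single, reflect_single_zero, shiftMul_single, shiftPow_zero,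
      AddMonoidHom.flip_apply]
  · rw [map_single, map_single, ← zMul_single, reflect_zMul, AddMonoidHom.neg_apply]
  · rw [← zMul_single, reflect_zMul, map_neg, AddMonoidHom.neg_apply, AddMonoidHom.neg_apply,
      zAdd_shiftMul (TA := T') fun x a => h a x]

theorem reflect_shiftMul {β : A →+ W →+ W} {T : A →+ A} {T' : W →+ W}
    (h : ∀ a x, T' (β a x) = β a (T' x) + β (T a) x) (a : Laurent A) (f : Laurent W) :
    reflect T' (shiftMul β T' a f) = shiftMul β.flip T (reflect T' f) (reflect T a) := by
  refine DFunLike.congr_fun (IsBounded.ext (F := (reflect T').comp ((shiftMul β T').flip f))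
    (G := (shiftMul β.flip T (reflect T' f)).comp (reflect T))
    ((IsBounded.reflect T').comp (.shiftMul_flip _ _ _))
    ((IsBounded.shiftMul _ _ _).comp (.reflect T)) fun n e => ?_) a
  have hsurj : Function.Surjective (zAdd T') := fun f => ⟨_, zAdd_shiftPow_neg_one T' f⟩
  refine congrFun (eq_of_injective_rec hsurj.injective_comp_right
    (f := fun n f => reflect T' (shiftMul β T' (single n e) f))
    (g := fun n f => shiftMul β.flip T (reflect T' f) (reflect T (single n e))) ?_
    (fun n => ?_) (fun n => ?_) n) f
  · simp only [shiftMul_single, shiftPow_zero, reflect_single_zero, reflect_map h]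
  · simp only [← zMul_single, shiftMul_zMul_left]
    rfl
  · funext f
    simp only [Function.comp_apply, ← zMul_single, reflect_zMul, reflect_zAdd, map_neg,
      AddMonoidHom.neg_apply, shiftMul_zMul_left]

end Reflect

end Laurent

/-! ### Differential modules -/

section DiffModule

variable {F V : Type*} [Field F] [CommRing V] [Algebra F V] {D : Derivation F V V}

/-- The derivation `∂` as an additive map. -/
def derHom (D : Derivation F V V) : V →+ V := derEnd D

@[simp] theorem derHom_apply (v : V) : derHom D v = D v := rfl

/-- A differential module over `(V, D)`: a `V`-module structure on `W`, which need not be the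
canonical one, together with an operator satisfying the Leibniz rule over `D`. -/
structure DiffModule (D : Derivation F V V) (W : Type*) [AddCommGroup W] where
  /-- the action of `V` -/
  act : V →+ W →+ W
  /-- the derivation of the module -/
  der : W →+ W
  act_one : ∀ x, act 1 x = x
  act_mul : ∀ a b x, act (a * b) x = act a (act b x)
  der_act : ∀ a x, der (act a x) = act a (der x) + act (D a) x

namespace DiffModule

variable {W W' : Type*} [AddCommGroup W] [AddCommGroup W'] (S : DiffModule D W)

/-- `V` as a differential module over itself. -/
def self (D : Derivation F V V) : DiffModule D V where
  act := smulAddHom V V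
  der := derHom D
  act_one := one_smul V
  act_mul := mul_smul
  der_act a b := by simp [mul_comm b]

/-- `W((z⁻¹))` with the coefficientwise action and derivation. -/
def laurent : DiffModule D (Laurent W) where
  act := Laurent.map.comp S.act
  der := Laurent.map S.der
  act_one f := Laurent.ext fun n => S.act_one (f n)
  act_mul a b f := Laurent.ext fun n => S.act_mul a b (f n)
  der_act a f := Laurent.ext fun n => S.der_act a (f n)

/-- The action `a(z + ∂) f(z)` of the operator with symbol `a` on `f`, from the left. -/
def left : Laurent V →+ Laurent W →+ Laurent W := Laurent.shiftMul S.act S.der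

/-- The action `f(z + ∂) a(z)` of the operator with symbol `a` on `f`, from the right. -/
def right : Laurent V →+ Laurent W →+ Laurent W := (Laurent.shiftMul S.act.flip (derHom D)).flip

theorem act_comm (a b : V) (x : W) : S.act a (S.act b x) = S.act b (S.act a x) := by
  rw [← S.act_mul, mul_comm, S.act_mul]

theorem one_left (f : Laurent W) : S.left (.single 0 1) f = f := by
  rw [left, Laurent.shiftMul_single, Laurent.shiftPow_zero]
  exact Laurent.ext fun n => S.act_one (f n)

theorem one_right (f : Laurent W) : S.right (.single 0 1) f = f := by
  rw [right, AddMonoidHom.flip_apply, Laurent.shiftMul_single_zero_right _ (by simp)]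
  exact Laurent.ext fun n => S.act_one (f n)

theorem mul_left (a b : Laurent V) (f : Laurent W) :
    S.left ((self D).left a b) f = S.left a (S.left b f) :=
  Laurent.shiftMul_assoc (fun a b x => S.act_mul a b x)
    (fun b x => (S.der_act b x).trans (add_comm _ _)) a b f

theorem mul_right (a b : Laurent V) (f : Laurent W) :
    S.right ((self D).left a b) f = S.right b (S.right a f) :=
  (Laurent.shiftMul_assoc (fun x a b => by
      simp only [AddMonoidHom.flip_apply]
      rw [← S.act_mul, mul_comm]
      rfl)
    (fun a b => ((self D).der_act a b).trans (add_comm _ _)) f a b).symm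

theorem left_right_comm (a b : Laurent V) (f : Laurent W) :
    S.left a (S.right b f) = S.right b (S.left a f) :=
  (Laurent.shiftMul_assoc (fun a x b => S.act_comm b a x) (fun x b => S.der_act b x) a f b).symm

theorem reflect_left (a : Laurent V) (f : Laurent W) :
    Laurent.reflect S.der (S.left a f) =
      S.right (Laurent.reflect (derHom D) a) (Laurent.reflect S.der f) :=
  Laurent.reflect_shiftMul (fun a x => S.der_act a x) a f

theorem reflect_right (a : Laurent V) (f : Laurent W) :
    Laurent.reflect S.der (S.right a f) =
      S.left (Laurent.reflect (derHom D) a) (Laurent.reflect S.der f) := by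
  rw [← Laurent.reflect_reflect S.der (S.left _ _), reflect_left, Laurent.reflect_reflect,
    Laurent.reflect_reflect]

variable {S} {S' : DiffModule D W'} {η : W →+ W'}

theorem map_left (hact : ∀ a x, η (S.act a x) = S'.act a (η x))
    (hder : ∀ x, η (S.der x) = S'.der (η x)) (a : Laurent V) (f : Laurent W) :
    Laurent.map η (S.left a f) = S'.left a (Laurent.map η f) :=
  Laurent.map_shiftMul (α := .id V) hact hder a f

theorem map_right (hact : ∀ a x, η (S.act a x) = S'.act a (η x)) (a : Laurent V)
    (f : Laurent W) : Laurent.map η (S.right a f) = S'.right a (Laurent.map η f) :=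
  Laurent.map_shiftMul (β' := S'.act.flip) (T := derHom D) (T' := derHom D) (η := .id V)
    (fun x a => hact a x) (fun _ => rfl) f a

end DiffModule

end DiffModule

/-! ### The Adler identity in bimodules -/

section AdlerSystem

/-- A group with commuting left and right actions of a ring. -/
structure Bimodule (P M : Type*) [Ring P] [AddCommGroup M] where
  /-- the left action -/
  left : P →+ M →+ M
  /-- the right action -/
  right : P →+ M →+ M
  one_left : ∀ x, left 1 x = x
  mul_left : ∀ a b x, left (a * b) x = left a (left b x)
  one_right : ∀ x, right 1 x = x
  mul_right : ∀ a b x, right (a * b) x = right b (right a x)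
  left_right_comm : ∀ a b x, left a (right b x) = right b (left a x)

namespace Bimodule

variable {P M n : Type*} [Ring P] [AddCommGroup M] (X : Bimodule P M) [Fintype n] [DecidableEq n]

theorem sum_left_left {A A' : Matrix n n P} (h : A' * A = 1) (i j : n) (x : M) :
    ∑ k, X.left (A' i k) (X.left (A k j) x) = if i = j then x else 0 := by
  simp only [← X.mul_left]
  rw [← AddMonoidHom.finsetSum_apply, ← map_sum, ← Matrix.mul_apply, h, Matrix.one_apply]
  split_ifs
  · exact X.one_left x
  · rw [map_zero, AddMonoidHom.zero_apply]

theorem sum_right_right {A A' : Matrix n n P} (h : A * A' = 1) (i j : n) (x : M) :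
    ∑ k, X.right (A' k j) (X.right (A i k) x) = if i = j then x else 0 := by
  simp only [← X.mul_right]
  rw [← AddMonoidHom.finsetSum_apply, ← map_sum, ← Matrix.mul_apply, h, Matrix.one_apply]
  split_ifs
  · exact X.one_right x
  · rw [map_zero, AddMonoidHom.zero_apply]

/-- `δ` is a derivation with values in the bimodule. -/
def IsDerivation (δ : P →+ M) : Prop := ∀ a b, δ (a * b) = X.left a (δ b) + X.right b (δ a)

variable {X}

theorem IsDerivation.map_one {δ : P →+ M} (hδ : X.IsDerivation δ) : δ 1 = 0 := by
  have h := hδ 1 1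
  rwa [mul_one, X.one_left, X.one_right, left_eq_add] at h

theorem IsDerivation.map_inverse {δ : P →+ M} (hδ : X.IsDerivation δ) {A A' : Matrix n n P}
    (h : A * A' = 1) (h' : A' * A = 1) (i j : n) :
    δ (A' i j) = -∑ p, ∑ q, X.left (A' i p) (X.right (A' q j) (δ (A p q))) := by
  have hzero (p : n) : ∑ q, (X.left (A p q) (δ (A' q j)) + X.right (A' q j) (δ (A p q))) = 0 := by
    simp only [← hδ _ _]
    rw [← map_sum, ← Matrix.mul_apply, h, Matrix.one_apply]
    split_ifs
    exacts [hδ.map_one, map_zero δ]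
  have hA' : ∑ p, ∑ q, X.left (A' i p) (X.left (A p q) (δ (A' q j))) = δ (A' i j) := by
    rw [Finset.sum_comm]
    simp only [X.sum_left_left h', Finset.sum_ite_eq, Finset.mem_univ, if_true]
  rw [← hA', eq_neg_iff_add_eq_zero, ← Finset.sum_add_distrib]
  refine Finset.sum_eq_zero fun p _ => ?_
  rw [← Finset.sum_add_distrib]
  simp only [← map_add, ← map_sum, hzero, map_zero]

end Bimodule

/-- The formal structure behind the Adler identity: two commuting bimodules over the ring `P` of
operators, for the variables `z` and `w`, a biderivation `br`, for `{a(z)_λ b(w)}`, and an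
element `kernel`, for `ι_z (z - w - λ - ∂)⁻¹`. -/
structure AdlerSystem (P M : Type*) [Ring P] [AddCommGroup M] where
  /-- the actions in the variable `z` -/
  fst : Bimodule P M
  /-- the actions in the variable `w` -/
  snd : Bimodule P M
  left_left : ∀ a b x, snd.left a (fst.left b x) = fst.left b (snd.left a x)
  left_right : ∀ a b x, snd.left a (fst.right b x) = fst.right b (snd.left a x)
  right_left : ∀ a b x, snd.right a (fst.left b x) = fst.left b (snd.right a x)
  right_right : ∀ a b x, snd.right a (fst.right b x) = fst.right b (snd.right a x)
  /-- the bracket -/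
  br : P →+ P →+ M
  br_mul_left : ∀ c, fst.IsDerivation (br.flip c)
  br_mul_right : ∀ a, snd.IsDerivation (br a)
  /-- the kernel of the Adler identity -/
  kernel : M

namespace AdlerSystem

variable {P M : Type*} [Ring P] [AddCommGroup M] (Z : AdlerSystem P M) {m n p : Type*}

/-- The right-hand side of the Adler identity. -/
def adler (a b : P) : M :=
  Z.snd.left a (Z.fst.left b Z.kernel) - Z.fst.right a (Z.snd.right b Z.kernel)

/-- The Adler identity for a matrix over `P`. -/
def IsAdler (A : Matrix m n P) : Prop :=
  ∀ i j h k, Z.br (A i j) (A h k) = Z.adler (A h j) (A i k)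

variable {Z}

theorem br_mul_mul {a b c d : P} (had : Z.br a d = 0) (hbc : Z.br b c = 0) :
    Z.br (a * b) (c * d) =
      Z.fst.left a (Z.snd.left c (Z.br b d)) + Z.fst.right b (Z.snd.right d (Z.br a c)) := by
  have h := Z.br_mul_left (c * d) a b
  simp only [AddMonoidHom.flip_apply] at h
  rw [h, Z.br_mul_right b, Z.br_mul_right a, had, hbc, map_zero, map_zero, add_zero, zero_add]

theorem IsAdler.mul [Fintype n] {A : Matrix m n P} {B : Matrix n p P} (hA : Z.IsAdler A)
    (hB : Z.IsAdler B) (hAB : ∀ i j h k, Z.br (A i j) (B h k) = 0)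
    (hBA : ∀ i j h k, Z.br (B h k) (A i j) = 0) : Z.IsAdler (A * B) := by
  intro i j h k
  let mid (q r : n) : M := Z.fst.right (B q j) (Z.snd.right (B r k)
    (Z.fst.left (A i r) (Z.snd.left (A h q) Z.kernel)))
  let outer (q r : n) : M := Z.snd.left (A h q * B q j) (Z.fst.left (A i r * B r k) Z.kernel)
  let inner (q r : n) : M := Z.fst.right (A h q * B q j) (Z.snd.right (A i r * B r k) Z.kernel)
  have hterm (q r : n) : Z.br (A i r * B r j) (A h q * B q k) =
      outer q r - mid q r + (mid r q - inner r q) := by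
    rw [br_mul_mul (hAB _ _ _ _) (hBA _ _ _ _), hB, hA]
    simp only [adler, outer, mid, inner, map_sub, Z.fst.mul_left, Z.snd.mul_left, Z.fst.mul_right,
      Z.snd.mul_right, Z.left_left, Z.left_right, Z.right_left, Z.right_right,
      Z.fst.left_right_comm, Z.snd.left_right_comm]
  have hmid : ∑ q, ∑ r, mid r q = ∑ q, ∑ r, mid q r := Finset.sum_comm
  have hinner : ∑ q, ∑ r, inner r q = ∑ q, ∑ r, inner q r := Finset.sum_comm
  have hadler : Z.adler ((A * B) h j) ((A * B) i k) =
      ∑ q, ∑ r, outer q r - ∑ q, ∑ r, inner q r := by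
    simp only [adler, Matrix.mul_apply, map_sum, AddMonoidHom.finsetSum_apply, outer, inner]
    rw [Finset.sum_comm, Finset.sum_comm (f := fun r q => inner q r)]
  calc Z.br ((A * B) i j) ((A * B) h k)
      = ∑ q, ∑ r, Z.br (A i r * B r j) (A h q * B q k) := by
        simp only [Matrix.mul_apply, map_sum, AddMonoidHom.finsetSum_apply]
    _ = ∑ q, ∑ r, outer q r - ∑ q, ∑ r, inner q r := by
        simp only [hterm, Finset.sum_add_distrib, Finset.sum_sub_distrib, hmid, hinner]
        abel
    _ = Z.adler ((A * B) h j) ((A * B) i k) := hadler.symm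

section Inverse

variable [Fintype n] [DecidableEq n] {A A' : Matrix n n P}

theorem IsAdler.br_inverse (hA : Z.IsAdler A) (h : A * A' = 1) (h' : A' * A = 1) (p q i k : n) :
    Z.br (A p q) (A' i k) =
      (if p = k then ∑ r, Z.snd.left (A' i r) (Z.fst.right (A r q) Z.kernel) else 0) -
        if i = q then ∑ s, Z.snd.right (A' s k) (Z.fst.left (A p s) Z.kernel) else 0 := by
  have hleft : ∑ r, ∑ s, Z.snd.left (A' i r) (Z.snd.right (A' s k)
      (Z.snd.left (A r q) (Z.fst.left (A p s) Z.kernel))) =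
      if i = q then ∑ s, Z.snd.right (A' s k) (Z.fst.left (A p s) Z.kernel) else 0 := by
    rw [Finset.sum_comm]
    simp only [Z.snd.left_right_comm, ← map_sum, Z.snd.sum_left_left h']
    split_ifs
    · rfl
    · simp only [map_zero, Finset.sum_const_zero]
  have hright : ∑ r, ∑ s, Z.snd.left (A' i r) (Z.snd.right (A' s k)
      (Z.fst.right (A r q) (Z.snd.right (A p s) Z.kernel))) =
      if p = k then ∑ r, Z.snd.left (A' i r) (Z.fst.right (A r q) Z.kernel) else 0 := by
    simp only [← Z.right_right, ← map_sum, Z.snd.sum_right_right h]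
    split_ifs
    · rfl
    · simp only [map_zero, Finset.sum_const_zero]
  rw [(Z.br_mul_right (A p q)).map_inverse h h' i k]
  simp only [hA _ _ _ _, adler, map_sub, Finset.sum_sub_distrib, hleft, hright, neg_sub]

theorem IsAdler.inverse (hA : Z.IsAdler A) (h : A * A' = 1) (h' : A' * A = 1) (i j r k : n) :
    Z.br (A' i j) (A' r k) = -Z.adler (A' r j) (A' i k) := by
  have hleft : ∑ q, Z.fst.left (A' i k) (Z.fst.right (A' q j)
      (∑ t, Z.snd.left (A' r t) (Z.fst.right (A t q) Z.kernel))) =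
      Z.snd.left (A' r j) (Z.fst.left (A' i k) Z.kernel) := by
    simp only [map_sum]
    rw [Finset.sum_comm]
    simp only [← Z.left_right, ← Z.left_left, ← map_sum, Z.fst.sum_right_right h]
    simp [apply_ite]
  have hright : ∑ p, Z.fst.left (A' i p) (Z.fst.right (A' r j)
      (∑ s, Z.snd.right (A' s k) (Z.fst.left (A p s) Z.kernel))) =
      Z.fst.right (A' r j) (Z.snd.right (A' i k) Z.kernel) := by
    simp only [map_sum]
    rw [Finset.sum_comm]
    simp only [Z.fst.left_right_comm, ← Z.right_left, ← map_sum, Z.fst.sum_left_left h']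
    simp [apply_ite]
  have hbr := (Z.br_mul_left (A' r k)).map_inverse h h' i j
  simp only [AddMonoidHom.flip_apply, hA.br_inverse h h', map_sub, Finset.sum_sub_distrib,
    apply_ite (Z.fst.left _), apply_ite (Z.fst.right _), map_zero, Finset.sum_ite_irrel,
    Finset.sum_const_zero, Finset.sum_ite_eq, Finset.sum_ite_eq', Finset.mem_univ, if_true,
    hleft, hright] at hbr
  rw [hbr, adler]

end Inverse

/-- An involution of an Adler system reversing products, for the formal adjoint of operators. -/
structure Involution (Z : AdlerSystem P M) where
  /-- the involution of the ring -/
  star : P →+ P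
  /-- the involution of the values of the bracket -/
  refl : M →+ M
  refl_fst_left : ∀ a x, refl (Z.fst.left a x) = Z.fst.right (star a) (refl x)
  refl_fst_right : ∀ a x, refl (Z.fst.right a x) = Z.fst.left (star a) (refl x)
  refl_snd_left : ∀ a x, refl (Z.snd.left a x) = Z.snd.right (star a) (refl x)
  refl_snd_right : ∀ a x, refl (Z.snd.right a x) = Z.snd.left (star a) (refl x)
  br_star : ∀ a b, Z.br (star a) (star b) = refl (Z.br a b)
  refl_kernel : refl Z.kernel = -Z.kernel

theorem IsAdler.adjoint {A : Matrix m n P} (hA : Z.IsAdler A) (σ : Z.Involution) :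
    Z.IsAdler (A.transpose.map σ.star) := by
  intro i j h k
  simp only [Matrix.map_apply, Matrix.transpose_apply]
  rw [σ.br_star, hA, adler, map_sub, σ.refl_snd_left, σ.refl_fst_left, σ.refl_fst_right,
    σ.refl_snd_right, σ.refl_kernel, adler, Z.left_left, Z.right_right]
  simp only [map_neg]
  abel

end AdlerSystem

end AdlerSystem

/-! ### The ring of pseudodifferential operators -/

section PsiDO

variable {F V : Type*} [Field F] [CommRing V] [Algebra F V] {D : Derivation F V V}

/-- The ring `V((∂⁻¹))` of pseudodifferential operators, whose elements are given by their
symbols. The derivation is an argument because the product depends on it. -/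
def PsiDO (_D : Derivation F V V) : Type _ := Laurent V

namespace PsiDO

instance : AddCommGroup (PsiDO D) := inferInstanceAs (AddCommGroup (Laurent V))

instance : Ring (PsiDO D) where
  __ := (inferInstance : AddCommGroup (PsiDO D))
  mul := fun a b => (DiffModule.self D).left a b
  one := Laurent.single 0 (1 : V)
  left_distrib a b c := map_add ((DiffModule.self D).left a) b c
  right_distrib a b c := DFunLike.congr_fun (map_add (DiffModule.self D).left a b) c
  zero_mul a := DFunLike.congr_fun (map_zero (DiffModule.self D).left) a
  mul_zero a := map_zero ((DiffModule.self D).left a)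
  mul_assoc := (DiffModule.self D).mul_left
  one_mul := (DiffModule.self D).one_left
  mul_one := fun a : Laurent V =>
    (Laurent.shiftMul_single_zero_right _ D.map_one_eq_zero a).trans
      (Laurent.ext fun n => mul_one (a n))

end PsiDO

/-- The symbol of a pseudodifferential operator. -/
def PDO.symbol : PDO V →+ Laurent V :=
  AddMonoidHom.mk' (fun a => Laurent.ofFun a.1 a.2) fun _ _ => Laurent.ext fun _ => rfl

/-- A pseudodifferential operator, as an element of the ring of operators. -/
def PDO.toPsiDO (D : Derivation F V V) : PDO V →+ PsiDO D := PDO.symbol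

theorem shiftApply_eq_shiftMul {W : Type*} [AddCommGroup W] [Module V W] (T : W →+ W)
    (a : PDO V) (g : Laurent W) (q : ℤ) :
    shiftApply T a.1 g q = Laurent.shiftMul (smulAddHom V W) T a.symbol g q := by
  obtain ⟨a, N, hN⟩ := a
  obtain ⟨M, hM⟩ := g.exists_degLE
  have hfin : (fun x : ℤ × ℕ =>
      a x.1 • (Ring.choose x.1 x.2 • T^[x.2] (g (q - x.1 + x.2)))).HasFiniteSupport := by
    refine ((Set.finite_Icc (q - M) N).prod (Set.finite_Iic (M - q + N).toNat)).subset ?_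
    rintro ⟨n, k⟩ hk
    have hn : n ≤ N := by
      by_contra h
      exact hk (by simp only [hN n (by omega), zero_smul])
    have hnk : q - n + k ≤ M := by
      by_contra h
      exact hk (by simp only [hM (q - n + k) (by omega), iterate_map_zero, smul_zero])
    simp only [Set.mem_prod, Set.mem_Icc, Set.mem_Iic]
    omega
  calc shiftApply T a g q
      = ∑ᶠ x : ℤ × ℕ, a x.1 • (Ring.choose x.1 x.2 • T^[x.2] (g (q - x.1 + x.2))) := by
        simp only [shiftApply]
        rfl
    _ = ∑ᶠ (n : ℤ) (k : ℕ), a n • (Ring.choose n k • T^[k] (g (q - n + k))) :=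
        finsum_curry _ hfin
    _ = ∑ᶠ n : ℤ, a n • Laurent.shiftPow T n g q := finsum_congr fun n =>
        ((smulAddHom V W (a n)).map_finsum (Laurent.hasFiniteSupport_add_nat g
          (φ := fun k x => Ring.choose n k • T^[k] x)
          (fun k => by rw [iterate_map_zero, smul_zero]) (q - n))).symm

theorem PDO.toPsiDO_comp (a b : PDO V) :
    PDO.toPsiDO D (PDO.comp D a b) = PDO.toPsiDO D a * PDO.toPsiDO D b :=
  Laurent.ext fun q => shiftApply_eq_shiftMul (derHom D) a b.symbol q

theorem PDO.symbol_adjoint (a : PDO V) :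
    (PDO.adjoint D a).symbol = Laurent.reflect (derHom D) a.symbol :=
  Laurent.ext fun _ => rfl

theorem PDO.symbol_const (c : V) : (PDO.const c).symbol = Laurent.single 0 c :=
  Laurent.ext fun _ => rfl

theorem toPsiDO_matComp {m n p : Type*} [Fintype n] (A : Matrix m n (PDO V))
    (B : Matrix n p (PDO V)) :
    (matComp D A B).map (PDO.toPsiDO D) = A.map (PDO.toPsiDO D) * B.map (PDO.toPsiDO D) := by
  ext i j
  simp only [matComp, Matrix.map_apply, Matrix.of_apply, map_sum, PDO.toPsiDO_comp,
    Matrix.mul_apply]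

theorem toPsiDO_matConst_one {n : Type*} [DecidableEq n] :
    (matConst V (1 : Matrix n n F)).map (PDO.toPsiDO D) = 1 := by
  ext i j
  simp only [matConst, Matrix.map_apply, Matrix.of_apply, Matrix.one_apply]
  change PDO.symbol (PDO.const _) = _
  rw [PDO.symbol_const]
  split_ifs
  · rw [map_one]; rfl
  · rw [map_zero, map_zero]; rfl

end PsiDO

/-! ### The kernel `ι_z (z - w - λ - ∂)⁻¹` -/

section Compatible

/-- A bimodule structure applied to all coefficients. -/
def Bimodule.laurent {P M : Type*} [Ring P] [AddCommGroup M] (X : Bimodule P M) :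
    Bimodule P (Laurent M) where
  left := Laurent.map.comp X.left
  right := Laurent.map.comp X.right
  one_left f := Laurent.ext fun n => X.one_left (f n)
  mul_left a b f := Laurent.ext fun n => X.mul_left a b (f n)
  one_right f := Laurent.ext fun n => X.one_right (f n)
  mul_right a b f := Laurent.ext fun n => X.mul_right a b (f n)
  left_right_comm a b f := Laurent.ext fun n => X.left_right_comm a b (f n)

namespace DiffModule

open Laurent

variable {F V W : Type*} [Field F] [CommRing V] [Algebra F V] {D : Derivation F V V}
  [AddCommGroup W]

/-- The bimodule `W((z⁻¹))` over the ring of pseudodifferential operators. -/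
def bimodule (S : DiffModule D W) : Bimodule (PsiDO D) (Laurent W) where
  left := S.left
  right := S.right
  one_left := S.one_left
  mul_left := S.mul_left
  one_right := S.one_right
  mul_right := S.mul_right
  left_right_comm := S.left_right_comm

theorem isDerivation_map (S : DiffModule D W) {δ : V →+ W}
    (hmul : ∀ a b, δ (a * b) = S.act a (δ b) + S.act b (δ a))
    (hder : ∀ a, δ (D a) = S.der (δ a)) : S.bimodule.IsDerivation (P := PsiDO D) (map δ) :=
  fun a b => (map_shiftMul_of_leibniz (β₁ := S.act.flip) (β₂ := S.act) (T := derHom D)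
    (T' := S.der) (fun x y => (hmul x y).trans (add_comm _ _)) hder a b).trans (add_comm _ _)

theorem zAdd_right (S : DiffModule D W) (b : Laurent V) (f : Laurent W) :
    zAdd S.der (S.right b f) = S.right b (zAdd S.der f) :=
  zAdd_shiftMul (β := S.act.flip) (TA := S.der) (TB := derHom D) (fun x a => S.der_act a x) f b

theorem left_single_zero (S : DiffModule D W) (c : V) (f : Laurent W) :
    S.left (single 0 c) f = map (S.act c) f := by
  rw [left, shiftMul_single, shiftPow_zero]

theorem right_single_zero (S : DiffModule D W) {c : V} (hc : D c = 0) (f : Laurent W) :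
    S.right (single 0 c) f = map (S.act c) f :=
  shiftMul_single_zero_right S.act.flip hc f

theorem right_apply_single_zero (S : DiffModule D W) (b : Laurent V) (e : W) :
    S.right b (single 0 e) = map (S.act.flip e) b := by
  rw [right, AddMonoidHom.flip_apply, shiftMul_single, shiftPow_zero]

/-- Two commuting structures of a differential module that agree on the vector `e`, where their
derivations are opposite. -/
structure Compatible (S₁ S₂ : DiffModule D W) (e : W) : Prop where
  act_act : ∀ a b x, S₁.act a (S₂.act b x) = S₂.act b (S₁.act a x)
  act_der : ∀ a x, S₁.act a (S₂.der x) = S₂.der (S₁.act a x)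
  der_act : ∀ a x, S₁.der (S₂.act a x) = S₂.act a (S₁.der x)
  der_der : ∀ x, S₁.der (S₂.der x) = S₂.der (S₁.der x)
  act_eq : ∀ a, S₁.act a e = S₂.act a e
  der_eq : S₁.der e = -S₂.der e

/-- The series `ι_z (z - w - ∂)⁻¹ e`, where `∂` is the derivation of the module. -/
def kernel (S : DiffModule D W) (e : W) : Laurent (Laurent W) :=
  shiftPow (-zAdd S.der) (-1) (single 0 (single 0 e))

namespace Compatible

variable {S₁ S₂ : DiffModule D W} {e : W} (h : Compatible S₁ S₂ e)
include h

theorem map_act_left (a : V) (b : Laurent V) (f : Laurent W) :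
    map (S₁.act a) (S₂.left b f) = S₂.left b (map (S₁.act a) f) :=
  map_left (h.act_act a) (h.act_der a) b f

theorem map_act_right (a : V) (b : Laurent V) (f : Laurent W) :
    map (S₁.act a) (S₂.right b f) = S₂.right b (map (S₁.act a) f) :=
  map_right (h.act_act a) b f

theorem map_der_left (b : Laurent V) (f : Laurent W) :
    map S₁.der (S₂.left b f) = S₂.left b (map S₁.der f) :=
  map_left h.der_act h.der_der b f

theorem map_der_right (b : Laurent V) (f : Laurent W) :
    map S₁.der (S₂.right b f) = S₂.right b (map S₁.der f) :=
  map_right h.der_act b f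

theorem left_left (a b : Laurent V) (x : Laurent (Laurent W)) :
    map (S₂.left a) (S₁.laurent.left b x) = S₁.laurent.left b (map (S₂.left a) x) :=
  map_left (fun v f => (h.map_act_left v a f).symm) (fun f => (h.map_der_left a f).symm) b x

theorem left_right (a b : Laurent V) (x : Laurent (Laurent W)) :
    map (S₂.left a) (S₁.laurent.right b x) = S₁.laurent.right b (map (S₂.left a) x) :=
  map_right (fun v f => (h.map_act_left v a f).symm) b x

theorem right_left (a b : Laurent V) (x : Laurent (Laurent W)) :
    map (S₂.right a) (S₁.laurent.left b x) = S₁.laurent.left b (map (S₂.right a) x) :=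
  map_left (fun v f => (h.map_act_right v a f).symm) (fun f => (h.map_der_right a f).symm) b x

theorem right_right (a b : Laurent V) (x : Laurent (Laurent W)) :
    map (S₂.right a) (S₁.laurent.right b x) = S₁.laurent.right b (map (S₂.right a) x) :=
  map_right (fun v f => (h.map_act_right v a f).symm) b x

theorem left_shiftPow (b : Laurent V) (x : Laurent (Laurent W)) :
    S₁.laurent.left b (shiftPow (-zAdd S₂.der) (-1) x) =
      shiftPow (-zAdd S₂.der) (-1) (S₁.laurent.left b x) := by
  have hmap (f : Laurent (Laurent W)) :
      map (-zAdd S₂.der) (S₁.laurent.left b f) =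
        S₁.laurent.left b (map (-zAdd S₂.der) f) := by
    simp only [map_neg, AddMonoidHom.neg_apply]
    rw [map_left (S' := S₁.laurent) (fun v f => (map_zAdd (h.act_der v) f).symm)
      (fun f => (map_zAdd h.der_der f).symm)]
  refine shiftPow_comm (fun f => ?_) (-1) x
  rw [zAdd_eq, map_add, zAdd_eq, hmap]
  exact congrArg (· + _) (shiftMul_zMul_right _ _ b f)

theorem zAdd_kernel : zAdd (map S₁.der - zMul) (S₂.kernel e) = single 0 (single 0 e) := by
  have hker : map (map (S₁.der + S₂.der)) (S₂.kernel e) = 0 := by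
    rw [kernel, map_shiftPow (T' := -zAdd S₂.der), map_single, map_single, AddMonoidHom.add_apply,
      h.der_eq, neg_add_cancel, map_zero, map_zero, map_zero]
    intro f
    simp only [AddMonoidHom.neg_apply, map_neg]
    rw [map_zAdd fun x => ?_]
    simp only [AddMonoidHom.add_apply, map_add, h.der_der]
  have hsplit : Laurent.map S₁.der - zMul = -zAdd S₂.der + Laurent.map (S₁.der + S₂.der) := by
    rw [map_add, zAdd]
    abel
  rw [hsplit, zAdd_eq, map_add, AddMonoidHom.add_apply, hker, add_zero, ← zAdd_eq, kernel,
    zAdd_shiftPow_neg_one]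

/-- Both sides have the same image under the injective map `z - w + ∂₁`, with `∂₁` the derivation
of `S₁`. -/
theorem right_kernel (a : Laurent V) :
    S₁.laurent.right a (S₂.kernel e) = shiftMul S₂.laurent.act 0 a (S₂.kernel e) := by
  have hact : S₁.laurent.act.flip (single 0 e) = S₂.laurent.act.flip (single 0 e) :=
    AddMonoidHom.ext fun v => by
      change map (S₁.act v) (single 0 e) = map (S₂.act v) (single 0 e)
      rw [map_single, map_single, h.act_eq]
  have hright (f : Laurent (Laurent W)) : zAdd (map S₁.der - zMul) (S₁.laurent.right a f) =
      S₁.laurent.right a (zAdd (map S₁.der - zMul) f) :=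
    zAdd_shiftMul (β := S₁.laurent.act.flip) (fun f v => Laurent.ext fun n => by
      change S₁.der (S₁.act v (f n)) - S₁.act v (f (n - 1)) =
        S₁.act v (S₁.der (f n) - f (n - 1)) + S₁.act (D v) (f n)
      rw [S₁.der_act, map_sub (S₁.act v)]
      abel) f a
  have hmap (f : Laurent (Laurent W)) :
      map (map S₁.der - zMul) (shiftMul S₂.laurent.act 0 a f) =
        shiftMul S₂.laurent.act 0 a (map (map S₁.der - zMul) f) :=
    map_shiftMul (α := .id V) (fun v (f : Laurent W) => Laurent.ext fun n => by
      change S₁.der (S₂.act v (f n)) - S₂.act v (f (n - 1)) =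
        S₂.act v (S₁.der (f n) - f (n - 1))
      rw [h.der_act, map_sub (S₂.act v)]) (fun _ => map_zero (Laurent.map S₁.der - zMul)) a f
  apply zAdd_injective (map S₁.der - zMul)
  rw [hright, h.zAdd_kernel, right_apply_single_zero, hact]
  rw [zAdd_eq, hmap, ← shiftMul_zMul_right, ← map_add, ← zAdd_eq, h.zAdd_kernel,
    shiftMul_single_zero_right _ rfl]

end Compatible

end DiffModule

end Compatible

namespace DiffModule

open Laurent

section Kernel

variable {F V W : Type*} [Field F] [CommRing V] [Algebra F V] {D : Derivation F V V}
  [AddCommGroup W] {S₁ S₂ : DiffModule D W} {e : W}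

theorem right_shiftPow (S : DiffModule D W) (b : Laurent V) (x : Laurent (Laurent W)) :
    map (S.right b) (shiftPow (-zAdd S.der) (-1) x) =
      shiftPow (-zAdd S.der) (-1) (map (S.right b) x) :=
  map_shiftPow (fun f => by
    rw [AddMonoidHom.neg_apply, map_neg, AddMonoidHom.neg_apply, S.zAdd_right]) (-1) x

namespace Compatible

variable (h : Compatible S₁ S₂ e)
include h

theorem left_kernel (b : Laurent V) :
    S₁.laurent.left b (S₂.kernel e) =
      shiftPow (-zAdd S₂.der) (-1) (map (single 0) (S₁.left b (single 0 e))) := by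
  have hmap : map (single 0) (S₁.left b (single 0 e)) =
      S₁.laurent.left b (single 0 (single 0 e)) := by
    rw [map_left (S' := S₁.laurent) (fun v x => (map_single (S₁.act v) 0 x).symm)
      (fun x => (map_single S₁.der 0 x).symm), map_single]
  rw [kernel, h.left_shiftPow, hmap]

theorem right_right_kernel (a b : Laurent V) :
    S₁.laurent.right a (map (S₂.right b) (S₂.kernel e)) =
      shiftMul S₂.laurent.act 0 a
        (shiftPow (-zAdd S₂.der) (-1) (single 0 (S₂.right b (single 0 e)))) := by
  rw [← h.right_right, h.right_kernel, map_shiftMul (α := .id V) (η := S₂.right b) (T' := 0)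
    (β' := S₂.laurent.act) (fun v f => (map_right (S' := S₂) (S₂.act_comm v) b f).symm)
    (fun _ => map_zero (S₂.right b)), kernel, right_shiftPow, map_single]
  rfl

theorem left_left_kernel_of_const (a : V) {b : V} (hb : D b = 0) :
    map (S₂.left (single 0 a)) (S₁.laurent.left (single 0 b) (S₂.kernel e)) =
      S₁.laurent.right (single 0 a) (map (S₂.right (single 0 b)) (S₂.kernel e)) := by
  have hright (c : V) :
      S₁.laurent.right (single 0 c) (S₂.kernel e) = map (map (S₂.act c)) (S₂.kernel e) := by
    rw [h.right_kernel, shiftMul_single, shiftPow_zero]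
    rfl
  rw [left_single_zero, ← right_single_zero S₁.laurent hb, hright, ← h.right_right, hright]
  refine Laurent.ext fun p => ?_
  change S₂.left (single 0 a) (map (S₂.act b) _) = S₂.right (single 0 b) (map (S₂.act a) _)
  rw [left_single_zero, right_single_zero S₂ hb]
  exact Laurent.ext fun q => S₂.act_comm a b _

end Compatible

/-- The formal adjoint, with respect to both variables, of a series in `z` and `w`. -/
def reflect₂ (S₁ S₂ : DiffModule D W) : Laurent (Laurent W) →+ Laurent (Laurent W) :=
  (map (reflect S₂.der)).comp (reflect (map S₁.der))

namespace Compatible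

variable (h : Compatible S₁ S₂ e)
include h

theorem reflect₂_fst_left (a : Laurent V) (x : Laurent (Laurent W)) :
    reflect₂ S₁ S₂ (S₁.laurent.left a x) =
      S₁.laurent.right (reflect (derHom D) a) (reflect₂ S₁ S₂ x) := by
  change Laurent.map _ (reflect S₁.laurent.der _) = _
  rw [S₁.laurent.reflect_left,
    map_right (S' := S₁.laurent) fun v f => (map_reflect (h.act_der v) f).symm]
  rfl

theorem reflect₂_fst_right (a : Laurent V) (x : Laurent (Laurent W)) :
    reflect₂ S₁ S₂ (S₁.laurent.right a x) =
      S₁.laurent.left (reflect (derHom D) a) (reflect₂ S₁ S₂ x) := by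
  change Laurent.map _ (reflect S₁.laurent.der _) = _
  rw [S₁.laurent.reflect_right,
    map_left (S' := S₁.laurent) (fun v f => (map_reflect (h.act_der v) f).symm)
      fun f => (map_reflect h.der_der f).symm]
  rfl

theorem reflect₂_snd_left (a : Laurent V) (x : Laurent (Laurent W)) :
    reflect₂ S₁ S₂ (map (S₂.left a) x) =
      map (S₂.right (reflect (derHom D) a)) (reflect₂ S₁ S₂ x) := by
  change Laurent.map _ (reflect (Laurent.map S₁.der) (Laurent.map (S₂.left a) x)) = _
  rw [← map_reflect fun f => (h.map_der_left a f).symm]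
  exact Laurent.ext fun n => S₂.reflect_left a _

theorem reflect₂_snd_right (a : Laurent V) (x : Laurent (Laurent W)) :
    reflect₂ S₁ S₂ (map (S₂.right a) x) =
      map (S₂.left (reflect (derHom D) a)) (reflect₂ S₁ S₂ x) := by
  change Laurent.map _ (reflect (Laurent.map S₁.der) (Laurent.map (S₂.right a) x)) = _
  rw [← map_reflect fun f => (h.map_der_right a f).symm]
  exact Laurent.ext fun n => S₂.reflect_right a _

theorem reflect₂_kernel : reflect₂ S₁ S₂ (S₂.kernel e) = -S₂.kernel e := by
  set φ := S₂.kernel e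
  have hfst : reflect₂ S₁ S₂ (zAdd (map S₁.der) φ) = -zMul (reflect₂ S₁ S₂ φ) := by
    change Laurent.map _ (reflect (Laurent.map S₁.der) (zAdd (Laurent.map S₁.der) φ)) = _
    rw [reflect_zAdd, map_neg]
    rfl
  have hsnd : reflect₂ S₁ S₂ (map zMul φ) = -map (zAdd S₂.der) (reflect₂ S₁ S₂ φ) := by
    change Laurent.map _ (reflect (Laurent.map S₁.der) (Laurent.map zMul φ)) = _
    rw [← map_reflect (η := zMul) (T := Laurent.map S₁.der) fun _ => rfl]
    exact Laurent.ext fun n => reflect_zMul S₂.der _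
  have hone : reflect₂ S₁ S₂ (single 0 (single 0 e)) = single 0 (single 0 e) := by
    change Laurent.map _ (reflect (Laurent.map S₁.der) (single 0 (single 0 e))) = _
    rw [reflect_single_zero, map_single, reflect_single_zero]
  have hφ : zAdd (map S₁.der) φ - map zMul φ = single 0 (single 0 e) := by
    rw [← h.zAdd_kernel, zAdd_eq, zAdd_eq, map_sub, AddMonoidHom.sub_apply, add_sub_assoc]
  rw [← neg_eq_iff_eq_neg]
  apply zAdd_injective (-zAdd S₂.der)
  calc zAdd (-zAdd S₂.der) (-reflect₂ S₁ S₂ φ)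
      = reflect₂ S₁ S₂ (zAdd (map S₁.der) φ - map zMul φ) := by
        rw [map_sub, hfst, hsnd, zAdd_eq, map_neg, map_neg (Laurent.map _), map_neg,
          AddMonoidHom.neg_apply, neg_neg, sub_neg_eq_add]
    _ = zAdd (-zAdd S₂.der) φ := by
        rw [hφ, hone]
        exact (zAdd_shiftPow_neg_one _ _).symm

end Compatible

end Kernel

end DiffModule

theorem choose_neg_one_smul_iterate_neg {W : Type*} [AddCommGroup W] (U : W →+ W) (k : ℕ)
    (x : W) :
    Ring.choose (-1 : ℤ) k • (-U)^[k] x = U^[k] x := by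
  have hchoose : Ring.choose (-1 : ℤ) k = (-1) ^ k := by
    rw [Ring.choose_neg', Ring.multichoose_one, Units.smul_def, smul_eq_mul, mul_one]
    simp [Int.negOnePow_def]
  have hneg : (-U)^[k] x = (-1 : ℤ) ^ k • U^[k] x := by
    clear hchoose
    induction k with
    | zero => simp
    | succ k ih =>
      rw [Function.iterate_succ_apply', ih, AddMonoidHom.neg_apply, map_zsmul, pow_succ,
        mul_neg_one, neg_smul, Function.iterate_succ_apply']
  rw [hchoose, hneg, smul_smul, ← mul_pow, neg_mul_neg, one_mul, one_pow, one_smul]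

theorem iotaInv_eq_shiftPow {W : Type*} [AddCommGroup W] (T : W →+ W) (x : Laurent (Laurent W))
    (p q : ℤ) : iotaInv T (fun p q => x p q) p q =
      Laurent.shiftPow (-Laurent.zAdd T) (-1) x p q := by
  have hwAdd (k : ℕ) (p q : ℤ) :
      (wAdd T)^[k] (fun p q => x p q) p q = (Laurent.zAdd T)^[k] (x p) q := by
    induction k generalizing p q with
    | zero => rfl
    | succ k ih =>
      rw [Function.iterate_succ_apply', Function.iterate_succ_apply']
      change (wAdd T)^[k] _ p (q - 1) + T ((wAdd T)^[k] _ p q) = _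
      rw [ih, ih]
      rfl
  rw [Laurent.shiftPow_apply, Laurent.finsum_apply (Laurent.hasFiniteSupport_add_nat x
    (φ := fun k f => Ring.choose (-1 : ℤ) k • (-Laurent.zAdd T)^[k] f)
    (fun k => by rw [iterate_map_zero, smul_zero]) (p - -1))]
  refine finsum_congr fun k => ?_
  rw [hwAdd, choose_neg_one_smul_iterate_neg, show p - -1 + (k : ℤ) = p + k + 1 by ring]

/-! ### The two differential module structures of `V[λ]` -/

section LambdaModules

variable {F V : Type*} [Field F] [CommRing V] [Algebra F V] {D : Derivation F V V}

theorem lamAdd_monomial (n : ℕ) (c : V) :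
    lamAdd D (monomial n c) = monomial (n + 1) c + monomial n (D c) := by
  change X * monomial n c + (monomial n c).sum (fun n c => monomial n (D c)) = _
  rw [X_mul_monomial, sum_monomial_index _ _ (by simp)]

theorem lamAdd_smul (v : V) (P : V[X]) :
    lamAdd D (v • P) = v • lamAdd D P + D v • P := by
  induction P using Polynomial.induction_on' with
  | add P Q hP hQ =>
    simp only [smul_add, map_add, hP, hQ]
    abel
  | monomial n c =>
    simp only [smul_monomial, lamAdd_monomial, smul_eq_mul, Derivation.leibniz, map_add, smul_add,
      mul_comm c]
    abel

theorem lamAdd_X_mul (P : V[X]) : lamAdd D (X * P) = X * lamAdd D P := by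
  induction P using Polynomial.induction_on' with
  | add P Q hP hQ => simp only [mul_add, map_add, hP, hQ]
  | monomial n c => simp only [X_mul_monomial, lamAdd_monomial, mul_add]

theorem shiftEval_monomial (n : ℕ) (c b : V) :
    shiftEval D (monomial n c) b = c • (lamAdd D)^[n] (C b) := by
  rw [shiftEval, sum_monomial_index _ _ (by simp), AddMonoid.End.coe_pow, smul_eq_C_mul]

theorem shiftEval_add (P Q : V[X]) (b : V) :
    shiftEval D (P + Q) b = shiftEval D P b + shiftEval D Q b :=
  sum_add_index _ _ _ (by simp) fun _ _ _ => by rw [map_add, add_mul]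

theorem shiftEval_add_right (P : V[X]) (a b : V) :
    shiftEval D P (a + b) = shiftEval D P a + shiftEval D P b := by
  simp only [shiftEval, sum_def, map_add, mul_add, Finset.sum_add_distrib]

theorem shiftEval_smul (v : V) (P : V[X]) (b : V) :
    shiftEval D (v • P) b = v • shiftEval D P b := by
  induction P using Polynomial.induction_on' with
  | add P Q hP hQ => simp only [smul_add, shiftEval_add, hP, hQ]
  | monomial n c => simp only [smul_monomial, shiftEval_monomial, smul_eq_mul, mul_smul]

theorem shiftEval_lamAdd (P : V[X]) (b : V) :
    shiftEval D (lamAdd D P) b = lamAdd D (shiftEval D P b) := by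
  induction P using Polynomial.induction_on' with
  | add P Q hP hQ => simp only [shiftEval_add, map_add, hP, hQ]
  | monomial n c =>
    rw [lamAdd_monomial, shiftEval_add, shiftEval_monomial, shiftEval_monomial, shiftEval_monomial,
      lamAdd_smul, Function.iterate_succ_apply']

theorem shiftEval_X_mul (P : V[X]) (b : V) :
    shiftEval D (X * P) b = X * shiftEval D P b + shiftEval D P (D b) := by
  induction P using Polynomial.induction_on' with
  | add P Q hP hQ =>
    simp only [mul_add, shiftEval_add, hP, hQ]
    abel
  | monomial n c =>
    have hX : (lamAdd D)^[n] (X * C b) = X * (lamAdd D)^[n] (C b) :=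
      Function.Commute.iterate_left (f := lamAdd D) (g := fun P => X * P) lamAdd_X_mul n (C b)
    have hC : lamAdd D (C b) = X * C b + C (D b) := by
      rw [← monomial_zero_left, lamAdd_monomial, X_mul_monomial, monomial_zero_left]
    rw [X_mul_monomial, shiftEval_monomial, shiftEval_monomial, shiftEval_monomial,
      Function.iterate_succ_apply, hC, iterate_map_add, hX, smul_add, mul_smul_comm]

theorem shiftEval_one (P : V[X]) : shiftEval D P 1 = P := by
  induction P using Polynomial.induction_on' with
  | add P Q hP hQ => rw [shiftEval_add, hP, hQ]
  | monomial n c =>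
    have hpow : (lamAdd D)^[n] (C 1) = monomial n 1 := by
      induction n with
      | zero => rfl
      | succ n ih =>
        rw [Function.iterate_succ_apply', ih, lamAdd_monomial, D.map_one_eq_zero, map_zero,
          add_zero]
    rw [shiftEval_monomial, hpow, smul_monomial, smul_eq_mul, mul_one]

theorem shiftEval_mul (P : V[X]) (a b : V) :
    shiftEval D P (a * b) = shiftEval D (shiftEval D P b) a := by
  induction P using Polynomial.induction_on' with
  | add P Q hP hQ => simp only [shiftEval_add, hP, hQ]
  | monomial n c =>
    have hiter : shiftEval D ((lamAdd D)^[n] (C b)) a = (lamAdd D)^[n] (shiftEval D (C b) a) :=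
      Function.Semiconj.iterate_right (f := fun P => shiftEval D P a)
        (fun P => shiftEval_lamAdd P a) n (C b)
    have hC : shiftEval D (C b) a = C (a * b) := by
      rw [← monomial_zero_left, shiftEval_monomial, Function.iterate_zero_apply, smul_eq_C_mul,
        ← C_mul, mul_comm b]
    rw [shiftEval_monomial, shiftEval_monomial, shiftEval_smul, hiter, hC]

variable (D)

/-- `V[λ]` as the space where the symbols in `z` of `{a(z)_λ b(w)}` act: `v` acts by
`P(λ) ↦ P(λ + x)(|_{x=∂} v)`, and the derivation is multiplication by `-λ`. -/
def sourceModule : DiffModule D V[X] where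
  act := AddMonoidHom.mk' (fun v => AddMonoidHom.mk' (fun P => shiftEval D P v)
    fun P Q => shiftEval_add P Q v) fun a b => AddMonoidHom.ext fun P => shiftEval_add_right P a b
  der := -AddMonoidHom.mulLeft X
  act_one := shiftEval_one
  act_mul a b P := shiftEval_mul P a b
  der_act a P := by
    change -(X * shiftEval D P a) = shiftEval D (-(X * P)) a + shiftEval D P (D a)
    rw [shiftEval_neg, shiftEval_X_mul]
    abel

/-- `V[λ]` as the space where the symbols in `w` of `{a(z)_λ b(w)}` act: `V` acts by
multiplication, and the derivation is `λ + ∂`. -/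
def targetModule : DiffModule D V[X] where
  act := smulAddHom V V[X]
  der := lamAdd D
  act_one := one_smul V
  act_mul := mul_smul
  der_act := lamAdd_smul

end LambdaModules

section Comparison

open Laurent

variable {F V : Type*} [Field F] [CommRing V] [Algebra F V]

theorem shiftEval_one_left {D : Derivation F V V} (b : V) : shiftEval D 1 b = C b := by
  rw [← C_1, ← monomial_zero_left, shiftEval_monomial, Function.iterate_zero_apply, one_smul]

theorem compatible_sourceModule_targetModule (D : Derivation F V V) :
    (sourceModule D).Compatible (targetModule D) 1 where
  act_act a b P := shiftEval_smul b P a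
  act_der a P := shiftEval_lamAdd P a
  der_act a P := by
    change -(X * a • P) = a • -(X * P)
    rw [mul_smul_comm, smul_neg]
  der_der P := by
    change -(X * lamAdd D P) = lamAdd D (-(X * P))
    rw [map_neg, lamAdd_X_mul]
  act_eq a := by
    change shiftEval D 1 a = a • (1 : V[X])
    rw [shiftEval_one_left, smul_eq_C_mul, mul_one]
  der_eq := by
    change -(X * 1) = -lamAdd D 1
    rw [← C_1, ← monomial_zero_left, lamAdd_monomial, D.map_one_eq_zero, X_mul_monomial, map_zero,
      add_zero]

variable {D : Derivation F V V}

namespace LambdaBracket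

/-- The bracket `{a_λ b}`, as a biadditive map. -/
def brHom (L : LambdaBracket D) : V →+ V →+ V[X] :=
  AddMonoidHom.mk' (fun a => (L.br a).toAddMonoidHom) fun a b => by rw [map_add]; rfl

/-- The series `{a(z)_λ b(w)}`, for symbols `a` and `b`. -/
def seriesHom (L : LambdaBracket D) : PsiDO D →+ PsiDO D →+ Laurent (Laurent V[X]) :=
  (Laurent.map.comp (Laurent.map.comp L.brHom).flip).flip

/-- The Adler system of a `λ`-bracket: the coefficients are in `V[λ]`, where the operators in `z`
and in `w` act through the source and the target module. -/
def adlerSystem (L : LambdaBracket D) : AdlerSystem (PsiDO D) (Laurent (Laurent V[X])) where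
  fst := (sourceModule D).laurent.bimodule
  snd := (targetModule D).bimodule.laurent
  left_left := (compatible_sourceModule_targetModule D).left_left
  left_right := (compatible_sourceModule_targetModule D).left_right
  right_left := (compatible_sourceModule_targetModule D).right_left
  right_right := (compatible_sourceModule_targetModule D).right_right
  br := L.seriesHom
  br_mul_left := fun c : Laurent V => (sourceModule D).laurent.isDerivation_map
    (δ := (Laurent.map.comp L.brHom).flip c)
    (fun a b => Laurent.ext fun n => (L.leibniz_right a b (c n)).trans (add_comm _ _))
    (fun a => Laurent.ext fun n => L.sesq_left a (c n))
  br_mul_right := fun a b c : Laurent V => Laurent.ext fun n =>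
    (targetModule D).isDerivation_map (δ := L.brHom (a n)) (fun b c => by
      change L.br (a n) (b * c) = b • L.br (a n) c + c • L.br (a n) b
      rw [L.leibniz_left, smul_eq_C_mul, smul_eq_C_mul]
      ring)
    (L.sesq_right (a n)) b c
  kernel := (targetModule D).kernel 1

/-- The formal adjoint, as an involution of the Adler system. -/
def adjointInvolution (L : LambdaBracket D) : L.adlerSystem.Involution where
  star := reflect (derHom D)
  refl := (sourceModule D).reflect₂ (targetModule D)
  refl_fst_left := (compatible_sourceModule_targetModule D).reflect₂_fst_left
  refl_fst_right := (compatible_sourceModule_targetModule D).reflect₂_fst_right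
  refl_snd_left := (compatible_sourceModule_targetModule D).reflect₂_snd_left
  refl_snd_right := (compatible_sourceModule_targetModule D).reflect₂_snd_right
  br_star := fun a b : Laurent V => by
    let δ : V →+ Laurent V[X] := (Laurent.map.comp L.brHom).flip b
    have hfst : Laurent.map δ (reflect (derHom D) a) =
        reflect (Laurent.map (sourceModule D).der) (Laurent.map δ a) :=
      map_reflect (fun v => Laurent.ext fun n => L.sesq_left v (b n)) a
    change _ = Laurent.map _ (reflect (Laurent.map (sourceModule D).der) (Laurent.map δ a))
    rw [← hfst]
    exact Laurent.ext fun n => map_reflect (η := L.brHom (reflect (derHom D) a n))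
      (L.sesq_right (reflect (derHom D) a n)) b
  refl_kernel := (compatible_sourceModule_targetModule D).reflect₂_kernel

end LambdaBracket

theorem sourceModule_der_iterate (l : ℕ) (P : V[X]) :
    (sourceModule D).der^[l] P = (-1 : ℤ) ^ l • (P * X ^ l) := by
  induction l with
  | zero => simp
  | succ l ih =>
    rw [Function.iterate_succ_apply', ih, map_zsmul, pow_succ, mul_neg_one, neg_smul, ← smul_neg,
      pow_succ, ← mul_assoc, mul_comm _ X]
    rfl

theorem lamSub_adjoint (b : PDO V) (s : ℤ) :
    lamSub (PDO.adjoint D b) s = (sourceModule D).left b.symbol (single 0 1) s := by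
  have hlamSub (c : PDO V) : lamSub c s =
      reflect (sourceModule D).der ((sourceModule D).right c.symbol (single 0 1)) s := by
    rw [DiffModule.right_apply_single_zero, reflect_apply]
    refine finsum_congr fun l => ?_
    have hcoeff :
        Laurent.map ((sourceModule D).act.flip 1) c.symbol (s + l) = C (c.1 (s + l)) :=
      shiftEval_one_left _
    have hsign : (s.negOnePow : ℤ) = (s + l).negOnePow * (-1) ^ l := by
      rw [Int.negOnePow_add, Units.val_mul, mul_assoc]
      simp [Int.negOnePow_def, ← mul_pow]
    rw [sourceModule_der_iterate, hcoeff, smul_comm (Ring.choose _ _) ((-1 : ℤ) ^ l), hsign,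
      mul_smul]
  rw [hlamSub, DiffModule.reflect_right, PDO.symbol_adjoint, Laurent.reflect_reflect,
    reflect_single_zero]

theorem mulZ_eq_shiftMul {W : Type*} [AddCommGroup W] [Module V W] (a : PDO V)
    (x : Laurent (Laurent W)) (p q : ℤ) :
    mulZ a.1 (fun p q => x p q) p q =
      shiftMul (Laurent.map.comp (smulAddHom V W)) 0 a.symbol x p q := by
  have hshift (n : ℤ) : shiftPow 0 n x p = x (p - n) := by
    rw [shiftPow_apply, finsum_eq_single _ 0 fun k hk => ?_]
    · simp
    · rw [← Nat.succ_pred_eq_of_ne_zero hk, Function.iterate_succ_apply', AddMonoidHom.zero_apply,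
        smul_zero]
  rw [shiftMul_apply, Laurent.finsum_apply (hasFiniteSupport_shiftMul _ 0 a.symbol x p)]
  simp only [hshift]
  rfl

theorem adlerRHS_eq_adler (L : LambdaBracket D) (a b : PDO V) (p q : ℤ) :
    adlerRHS D a b p q = L.adlerSystem.adler (PDO.toPsiDO D a) (PDO.toPsiDO D b) p q := by
  have h := compatible_sourceModule_targetModule D
  have hleft : iotaInv (lamAdd D) (inZ (lamSub (PDO.adjoint D b))) = fun p q =>
      (sourceModule D).laurent.left b.symbol ((targetModule D).kernel 1) p q := by
    have hinZ : inZ (lamSub (PDO.adjoint D b)) =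
        fun p q => Laurent.map (single 0) ((sourceModule D).left b.symbol (single 0 1)) p q := by
      funext p q
      rw [inZ, lamSub_adjoint]
      rfl
    funext p q
    rw [h.left_kernel, hinZ]
    exact iotaInv_eq_shiftPow (lamAdd D) _ p q
  have hright : iotaInv (lamAdd D) (inW fun r => C (b.1 r)) = fun p q =>
      shiftPow (-zAdd (targetModule D).der) (-1)
        (single 0 ((targetModule D).right b.symbol (single 0 1))) p q := by
    have hinW : inW (fun r => C (b.1 r)) = fun p q =>
        single 0 ((targetModule D).right b.symbol (single 0 1)) p q := by
      funext p q
      rw [inW, DiffModule.right_apply_single_zero, single_apply]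
      split_ifs
      · exact ((smul_eq_C_mul _).trans (mul_one _)).symm
      · rfl
    funext p q
    rw [hinW]
    exact iotaInv_eq_shiftPow (lamAdd D) _ p q
  rw [adlerRHS, hleft, hright, mulZ_eq_shiftMul]
  refine congrArg₂ (· - ·) (shiftApply_eq_shiftMul (lamAdd D) a _ q) ?_
  exact (DFunLike.congr_fun (DFunLike.congr_fun (h.right_right_kernel _ _) p) q).symm

end Comparison

section Properties

variable {F V : Type*} [Field F] [CommRing V] [Algebra F V] {D : Derivation F V V}
  {L : LambdaBracket D} {m n p : Type*}

theorem series_eq_zero_iff (a b : PDO V) :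
    L.series a b = 0 ↔ L.adlerSystem.br (a.toPsiDO D) (b.toPsiDO D) = 0 :=
  ⟨fun h => Laurent.ext fun p => Laurent.ext fun q => congrFun₂ h p q,
    fun h => funext₂ fun p q => DFunLike.congr_fun (DFunLike.congr_fun h p) q⟩

theorem isAdler_iff (A : Matrix m n (PDO V)) :
    IsAdler L A ↔ L.adlerSystem.IsAdler (A.map (PDO.toPsiDO D)) := by
  refine forall₄_congr fun i j h k => ⟨fun hA => ?_, fun hA => ?_⟩
  · exact Laurent.ext fun p => Laurent.ext fun q =>
      (congrFun₂ hA p q).trans (adlerRHS_eq_adler L _ _ p q)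
  · funext p q
    rw [adlerRHS_eq_adler L]
    exact DFunLike.congr_fun (DFunLike.congr_fun hA p) q

theorem IsAdler.submatrix {m' n' : Type*} {A : Matrix m n (PDO V)} (hA : IsAdler L A)
    (f : m' → m) (g : n' → n) : IsAdler L (A.submatrix f g) :=
  fun i j h k => hA (f i) (g j) (f h) (g k)

theorem IsAdler.adjoint {A : Matrix m n (PDO V)} (hA : IsAdler L A) :
    IsAdler L (matAdjoint D A) :=
  (isAdler_iff _).mpr (((isAdler_iff A).mp hA).adjoint L.adjointInvolution)

theorem IsAdler.inverse [Fintype n] [DecidableEq n] {A A' : Matrix n n (PDO V)}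
    (hA : IsAdler L A) (h : matComp D A A' = matConst V (1 : Matrix n n F))
    (h' : matComp D A' A = matConst V (1 : Matrix n n F)) : IsAdler L.opposite A' := by
  have hmul {B B' : Matrix n n (PDO V)} (hB : matComp D B B' = matConst V (1 : Matrix n n F)) :
      B.map (PDO.toPsiDO D) * B'.map (PDO.toPsiDO D) = 1 := by
    rw [← toPsiDO_matComp, hB, toPsiDO_matConst_one]
  intro i j r k
  funext p q
  have hinv := ((isAdler_iff A).mp hA).inverse (hmul h) (hmul h') i j r k
  rw [adlerRHS_eq_adler L]
  exact DFunLike.congr_fun (DFunLike.congr_fun (neg_eq_iff_eq_neg.mpr hinv) p) q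

theorem IsAdler.comp [Fintype n] {A : Matrix m n (PDO V)} {B : Matrix n p (PDO V)}
    (hA : IsAdler L A) (hB : IsAdler L B) (hAB : ∀ i j h k, L.series (A i j) (B h k) = 0)
    (hBA : ∀ i j h k, L.series (B h k) (A i j) = 0) : IsAdler L (matComp D A B) := by
  rw [isAdler_iff, toPsiDO_matComp]
  exact ((isAdler_iff A).mp hA).mul ((isAdler_iff B).mp hB)
    (fun i j h k => (series_eq_zero_iff _ _).mp (hAB i j h k))
    fun i j h k => (series_eq_zero_iff _ _).mp (hBA i j h k)

theorem LambdaBracket.br_algebraMap_left (L : LambdaBracket D) (c : F) (b : V) :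
    L.br (algebraMap F V c) b = 0 := by
  have hone : L.br 1 b = 0 := by
    have h := L.leibniz_right 1 1 b
    rwa [mul_one, shiftEval_one, left_eq_add] at h
  rw [Algebra.algebraMap_eq_smul_one, map_smul, LinearMap.smul_apply, hone, smul_zero]

theorem LambdaBracket.br_algebraMap_right (L : LambdaBracket D) (a : V) (c : F) :
    L.br a (algebraMap F V c) = 0 := by
  have hone : L.br a 1 = 0 := by
    have h := L.leibniz_left a 1 1
    rwa [mul_one, C_1, mul_one, left_eq_add] at h
  rw [Algebra.algebraMap_eq_smul_one, map_smul, hone, smul_zero]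

theorem series_const_left (c : F) (a : PDO V) :
    L.series (PDO.const (algebraMap F V c)) a = 0 := by
  funext p q
  simp only [LambdaBracket.series, PDO.const]
  split_ifs
  · exact L.br_algebraMap_left c _
  · simp

theorem series_const_right (a : PDO V) (c : F) :
    L.series a (PDO.const (algebraMap F V c)) = 0 := by
  funext p q
  simp only [LambdaBracket.series, PDO.const]
  split_ifs
  · exact L.br_algebraMap_right _ c
  · simp

theorem isAdler_matConst (L : LambdaBracket D) (S : Matrix m n F) :
    IsAdler L (matConst V S) := by
  intro i j h k
  refine (series_const_left _ _).trans (funext₂ fun p q => Eq.symm ?_)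
  rw [adlerRHS_eq_adler L]
  exact DFunLike.congr_fun (DFunLike.congr_fun (sub_eq_zero.mpr
    ((compatible_sourceModule_targetModule D).left_left_kernel_of_const _
      (D.map_algebraMap (S i k)))) p) q

theorem IsAdler.matConst_comp_comp [Fintype m] [Fintype n] {p' : Type*} {A : Matrix m n (PDO V)}
    (hA : IsAdler L A) (S : Matrix p m F) (T : Matrix n p' F) :
    IsAdler L (matComp D (matComp D (matConst V S) A) (matConst V T)) := by
  refine ((isAdler_matConst L S).comp hA ?_ ?_).comp (isAdler_matConst L T) ?_ ?_
  · exact fun _ _ _ _ => series_const_left _ _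
  · exact fun _ _ _ _ => series_const_right _ _
  · exact fun _ _ _ _ => series_const_right _ _
  · exact fun _ _ _ _ => series_const_left _ _

end Properties

end AdlerType

end

theorem proposition3p3_general {F V : Type*} [Field F] [CommRing V] [Algebra F V]
    (D : Derivation F V V) (L : AdlerType.LambdaBracket D) :
    (∀ {m n m' n' : Type*} (A : Matrix m n (AdlerType.PDO V)), AdlerType.IsAdler L A →
      ∀ (f : m' → m) (g : n' → n), AdlerType.IsAdler L (A.submatrix f g)) ∧
    (∀ {m n : Type*} (A : Matrix m n (AdlerType.PDO V)), AdlerType.IsAdler L A →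
      AdlerType.IsAdler L (AdlerType.matAdjoint D A)) ∧
    (∀ {n : Type*} [Fintype n] [DecidableEq n] (A A' : Matrix n n (AdlerType.PDO V)),
      AdlerType.IsAdler L A →
      AdlerType.matComp D A A' = AdlerType.matConst V (1 : Matrix n n F) →
      AdlerType.matComp D A' A = AdlerType.matConst V (1 : Matrix n n F) →
      AdlerType.IsAdler L.opposite A') ∧
    (∀ {m n p : Type*} [Fintype n] (A : Matrix m n (AdlerType.PDO V))
      (B : Matrix n p (AdlerType.PDO V)),
      AdlerType.IsAdler L A → AdlerType.IsAdler L B →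
      (∀ i j h k, L.series (A i j) (B h k) = 0) →
      (∀ i j h k, L.series (B h k) (A i j) = 0) →
      AdlerType.IsAdler L (AdlerType.matComp D A B)) ∧
    (∀ {m n p q : Type*} [Fintype m] [Fintype n] (A : Matrix m n (AdlerType.PDO V)),
      AdlerType.IsAdler L A → ∀ (S : Matrix p m F) (T : Matrix n q F),
      AdlerType.IsAdler L
        (AdlerType.matComp D (AdlerType.matComp D (AdlerType.matConst V S) A)
          (AdlerType.matConst V T))) :=
  ⟨fun _ => .submatrix, fun _ => .adjoint, fun _ _ => .inverse, fun _ _ => .comp,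
    fun _ => .matConst_comp_comp⟩

theorem proposition3p3 {F V : Type*} [Field F] [CharZero F] [CommRing V] [Algebra F V]
    (D : Derivation F V V) (L : AdlerType.LambdaBracket D) :
    -- (a) submatrices; in particular, entries
    (∀ (M N : ℕ) (A : Matrix (Fin M) (Fin N) (AdlerType.PDO V)), AdlerType.IsAdler L A →
      (∀ (I : Set (Fin M)) (J : Set (Fin N)),
        AdlerType.IsAdler L
          (A.submatrix (fun i : I => (i : Fin M)) (fun j : J => (j : Fin N)))) ∧
      (∀ (i : Fin M) (j : Fin N),
        AdlerType.IsAdler L (Matrix.of fun (_ _ : Fin 1) => A i j))) ∧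
    -- (b) the formal adjoint
    (∀ (M N : ℕ) (A : Matrix (Fin M) (Fin N) (AdlerType.PDO V)), AdlerType.IsAdler L A →
      AdlerType.IsAdler L (AdlerType.matAdjoint D A)) ∧
    -- (c) the inverse, with respect to the opposite bracket
    (∀ (N : ℕ) (A A' : Matrix (Fin N) (Fin N) (AdlerType.PDO V)), AdlerType.IsAdler L A →
      AdlerType.matComp D A A' = AdlerType.matConst V (1 : Matrix (Fin N) (Fin N) F) →
      AdlerType.matComp D A' A = AdlerType.matConst V (1 : Matrix (Fin N) (Fin N) F) →
      AdlerType.IsAdler L.opposite A') ∧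
    -- (d) products
    (∀ (M N P : ℕ) (A : Matrix (Fin M) (Fin N) (AdlerType.PDO V))
      (B : Matrix (Fin N) (Fin P) (AdlerType.PDO V)),
      AdlerType.IsAdler L A → AdlerType.IsAdler L B →
      (∀ i j h k, L.series (A i j) (B h k) = 0) →
      (∀ i j h k, L.series (B h k) (A i j) = 0) →
      AdlerType.IsAdler L (AdlerType.matComp D A B)) ∧
    (∀ (M N P Q : ℕ) (A : Matrix (Fin M) (Fin N) (AdlerType.PDO V)), AdlerType.IsAdler L A →
      ∀ (S : Matrix (Fin P) (Fin M) F) (T : Matrix (Fin N) (Fin Q) F),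
      AdlerType.IsAdler L
        (AdlerType.matComp D (AdlerType.matComp D (AdlerType.matConst V S) A)
          (AdlerType.matConst V T))) := by
  obtain ⟨ha, hb, hc, hd, hconst⟩ := proposition3p3_general D L
  exact ⟨fun _ _ A hA => ⟨fun _ _ => ha A hA _ _, fun _ _ => ha A hA _ _⟩, fun _ _ => hb,
    fun _ => hc, fun _ _ _ => hd, fun _ _ _ _ => hconst⟩
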